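/- Let $p\ge 1$, let $\theta_1\in\mathbb R^p$ be a unit vector, $v>0$, and let $(r_n)_{n\ge1}$ be a bounded sequence of positive reals. For every $n$, let $X_{n1},\dots,X_{nn}$ be i.i.d. $\mathcal N(0,\Sigma_n)$ in $\mathbb R^p$ with $\Sigma_n=I_p+r_nv\,\theta_1\theta_1'$, and let $S_n=\frac1n\sum_{i=1}^n(X_{ni}-\bar X_n)(X_{ni}-\bar X_n)'$ with $\bar X_n=\frac1n\sum_{i=1}^nX_{ni}$. Let $\Gamma$ be a fixed orthogonal $p\times p$ matrix with first column $\theta_1$. Let $\hat\Gamma_n=(\hat\theta_{n1},\dots,\hat\theta_{np})$ be a random matrix such that, for $n\ge p$, almost surely it is orthogonal, its $j$th column $\hat\theta_{nj}$ is an eigenvector of $S_n$ for the $j$th largest eigenvalue, and, the signs being chosen accordingly, all entries in the first column of $$E_n:=\hat\Gamma_n'\Gamma=\begin{pmatrix}E_{n,11}&E_{n,12}\\E_{n,21}&E_{n,22}\end{pmatrix}$$ are positive; here $E_{n,11}$ is a scalar and $E_{n,22}$ is $(p-1)\times(p-1)$. Let $Z$ be a $p\times p$ random matrix with $\mathrm{vec}(Z)\sim\mathcal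 N(0,I_{p^2}+K_p)$, where $\mathrm{vec}$ stacks the columns and $K_p$ is the commutation matrix, defined by $K_p\,\mathrm{vec}(A)=\mathrm{vec}(A')$ for all $p\times p$ matrices $A$. For $a\ge0$, let $E(a)$ be a random orthogonal matrix whose $j$th row is, almost surely, the transpose of a unit eigenvector of $Z+\mathrm{diag}(a,0,\dots,0)$ for its $j$th largest eigenvalue, with signs chosen so that almost surely all entries in the first column of $E(a)$ are positive. Then, as $n\to\infty$: (i) if $r_n\equiv1$, then $E_{n,11}=1+o_{\rm P}(1)$, $E_{n,22}E_{n,22}'=I_{p-1}+o_{\rm P}(1)$, $\sqrt n\,E_{n,21}=O_{\rm P}(1)$, and both $\sqrt n\,E_{n,22}'E_{n,21}$ and $\sqrt n\,E_{n,12}'$ are asymptotically normal with mean zero and covariance matrix $v^{-2}(1+v)I_{p-1}$; (ii) if $r_n=o(1)$ and $\sqrt n\,r_n\to\infty$, then $E_{n,11}=1+o_{\rm P}(1)$, $E_{n,22}E_{n,22}'=I_{p-1}+o_{\rm P}(1)$, $\sqrt n\,r_n\,E_{n,21}=O_{\rm P}(1)$, and both $\sqrt n\,r_n\,E_{n,22}'E_{n,21}$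 and $\sqrt n\,r_n\,E_{n,12}'$ are asymptotically normal with mean zero and covariance matrix $v^{-2}I_{p-1}$; (iii) if $r_n=1/\sqrt n$, then $E_n$ converges weakly to $E(v)$; (iv) if $r_n=o(1/\sqrt n)$, then $E_n$ converges weakly to $E(0)$. -/

import Mathlib

open MeasureTheory ProbabilityTheory Filter Topology Asymptotics
open scoped Matrix

namespace SpikedPCA

noncomputable section

/-- `vec A`, the columns of `A` stacked on top of each other, as an element of Euclidean space. -/
def vecE {m n : Type*} (A : Matrix m n ℝ) : EuclideanSpace ℝ (n × m) :=
  WithLp.toLp 2 A.vec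

/-- The commutation matrix `K_p`, characterized by `K_p (vec A) = vec A'`. -/
def commutationMatrix (p : ℕ) : Matrix (Fin p × Fin p) (Fin p × Fin p) ℝ :=
  Matrix.of fun a b => if a = b.swap then 1 else 0

theorem commutationMatrix_mulVec_vec (p : ℕ) (A : Matrix (Fin p) (Fin p) ℝ) :
    commutationMatrix p *ᵥ A.vec = Aᵀ.vec := by
  ext a
  have h : ∀ b : Fin p × Fin p, (a = b.swap) = (b = a.swap) := fun b =>
    propext ⟨fun h => by rw [h, Prod.swap_swap], fun h => by rw [h, Prod.swap_swap]⟩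
  simp [commutationMatrix, Matrix.mulVec, dotProduct, h, Matrix.vec]

/-- The single-spiked covariance matrix `I + s θ θ'`. -/
def spikedCov {p : ℕ} (s : ℝ) (θ : EuclideanSpace ℝ (Fin p)) : Matrix (Fin p) (Fin p) ℝ :=
  1 + s • Matrix.vecMulVec θ.ofLp θ.ofLp

/-- Sample average of `x 0, …, x (n - 1)`. -/
def sampleMean {p n : ℕ} (x : Fin n → EuclideanSpace ℝ (Fin p)) : EuclideanSpace ℝ (Fin p) :=
  (n : ℝ)⁻¹ • ∑ i, x i

/-- Sample covariance matrix, with normalization `1 / n`. -/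
def sampleCov {p n : ℕ} (x : Fin n → EuclideanSpace ℝ (Fin p)) : Matrix (Fin p) (Fin p) ℝ :=
  (n : ℝ)⁻¹ • ∑ i, Matrix.vecMulVec (x i - sampleMean x).ofLp (x i - sampleMean x).ofLp

/-- The `p` columns of `U` are orthonormal eigenvectors of `A`, listed according to decreasing
eigenvalues: the `j`th column is a unit eigenvector for the `j`th largest eigenvalue of `A`
(eigenvalues being counted with multiplicity). -/
def IsEigenvectorMatrix {p : ℕ} (A U : Matrix (Fin p) (Fin p) ℝ) : Prop :=
  U ∈ Matrix.orthogonalGroup (Fin p) ℝ ∧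
    ∃ ev : Fin p → ℝ, Antitone ev ∧ ∀ j, A *ᵥ U.col j = ev j • U.col j

/-- The matrix `diag(a, 0, …, 0)`. -/
def diagFirst (q : ℕ) (a : ℝ) : Matrix (Fin (q + 1)) (Fin (q + 1)) ℝ :=
  Matrix.diagonal (Pi.single 0 a)

section Blocks

variable {q : ℕ} (E : Matrix (Fin (q + 1)) (Fin (q + 1)) ℝ)

/-- The top right block of `E`, transposed into a (column) vector. -/
def block12 : EuclideanSpace ℝ (Fin q) := WithLp.toLp 2 fun j => E 0 j.succ

/-- The bottom left block of `E`, a column vector. -/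
def block21 : EuclideanSpace ℝ (Fin q) := WithLp.toLp 2 fun i => E i.succ 0

/-- The bottom right block of `E`. -/
def block22 : Matrix (Fin q) (Fin q) ℝ := E.submatrix Fin.succ Fin.succ

/-- The vector `E₂₂' E₂₁`. -/
def block22T21 : EuclideanSpace ℝ (Fin q) :=
  WithLp.toLp 2 ((block22 E)ᵀ *ᵥ (block21 E).ofLp)

end Blocks

section Stochastic

variable {Ω : ℕ → Type*} [∀ n, MeasurableSpace (Ω n)] {F : Type*} [Norm F]

/-- `Y n = o_P(1)`, where `Y n` lives on its own probability space `(Ω n, P n)`. -/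
def IsLittleOP (P : ∀ n, Measure (Ω n)) (Y : ∀ n, Ω n → F) : Prop :=
  ∀ ε : ℝ, 0 < ε → Tendsto (fun n => P n {ω | ε ≤ ‖Y n ω‖}) atTop (𝓝 0)

/-- `Y n = O_P(1)`, where `Y n` lives on its own probability space `(Ω n, P n)`. -/
def IsBigOP (P : ∀ n, Measure (Ω n)) (Y : ∀ n, Ω n → F) : Prop :=
  ∀ ε : ℝ, 0 < ε → ∃ M : ℝ, ∀ n, P n {ω | M < ‖Y n ω‖} ≤ ENNReal.ofReal ε

end Stochastic

end

end SpikedPCA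

/-! Rotating by `Γ` turns the population covariance into `D²`, with `D = diag(√(1 + r v), 1, …, 1)`.
The whitened observations `D⁻¹ Γ' X` are standard Gaussian, so by the central limit theorem `H = √n
(S_U - I)`, with `S_U` their sample covariance, converges in law to `Z`; the covariance `I + K`
comes from the variance `2 tr(A²)` of a Gaussian quadratic form.

An increasing affine map of a symmetric matrix keeps its ordered eigenvectors. Hence `E'` is an
ordered eigenvector matrix of `√n (Γ' S Γ - I) = D H D + diag(√n r v, 0, …, 0)`: a tight matrix plus
a spike of size `√n r v`. What remains is perturbation theory (`isEigenvectorMatrix_of_sampleCov`).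

If `c = √n r → ∞`, the spike dominates. Let `w` be the leading eigenvector, `λ` its eigenvalue and
`T = D H D`. Then `λ / c → v` and `w → e₁`, while the lower rows of the eigenvalue equation read `(T
w)_i = λ w_i`; so `c w_i - T_{i0} / v → 0` (`tendsto_leading_eigenvector`). The off-diagonal entries
of `Z` in the first column are independent with unit variance and `T_{i0} = √(1 + r v) H_{i0}`,
which gives the stated covariances. The other blocks follow from orthogonality of `E`.

If `√n r v → a`, the matrix converges in law to `Z + diag(a, 0, …, 0)`. Having an admissible
eigenvector matrix in a closed set is a closed condition, by compactness of the orthogonal group,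
and portmanteau transfers convergence in law wherever the limiting eigenvector matrix is unique
(`tendstoInDistribution_eigenvectors`). Uniqueness holds once no eigenvector has first coordinate
zero. This is implied by a nonzero Krylov determinant, which holds almost surely: the determinant
vanishes at only finitely many points of each line in the direction of a path matrix, and the
Gaussian law has an independent nonatomic coefficient along that direction
(`ae_det_krylov_ne_zero`). -/

namespace SpikedPCA

/-! ### Limits uniform over events of a varying sample space -/

section UniformFilter

variable {Ω : ℕ → Type*}

/-- The filter of pairs `(n, ω)` with `n → ∞`, restricted to the event `good n`. -/
def uniformFilter (good : ∀ n, Ω n → Prop) : Filter (Σ n, Ω n) :=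
  comap Sigma.fst atTop ⊓ 𝓟 {p | good p.1 p.2}

/-- Uniformity in `ω` lets ordinary limit calculus along one filter replace in-probability estimates
on changing probability spaces. -/
theorem eventually_uniformFilter {good : ∀ n, Ω n → Prop} {Q : (Σ n, Ω n) → Prop} :
    (∀ᶠ p in uniformFilter good, Q p) ↔ ∀ᶠ n in atTop, ∀ ω, good n ω → Q ⟨n, ω⟩ := by
  rw [uniformFilter, eventually_inf_principal, eventually_comap]
  refine eventually_congr (Eventually.of_forall fun n => ⟨fun h ω => h ⟨n, ω⟩ rfl, ?_⟩)
  rintro h ⟨m, ω⟩ rfl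
  exact h ω

theorem tendsto_fst_uniformFilter (good : ∀ n, Ω n → Prop) :
    Tendsto Sigma.fst (uniformFilter good) atTop :=
  tendsto_comap.mono_left inf_le_left

/-- If `X` is tight and `Y` tends to zero uniformly on the events where `X` is bounded, then
`Y` tends to zero in probability. -/
theorem isLittleOP_of_uniformFilter {E F : Type*} [Norm E] [NormedAddCommGroup F]
    [∀ n, MeasurableSpace (Ω n)]
    {P : ∀ n, Measure (Ω n)} {X : ∀ n, Ω n → E} {Y : ∀ n, Ω n → F} {good : ∀ n, Ω n → Prop} (hX : IsBigOP P X)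
    (hgood : ∀ᶠ n in atTop, ∀ᵐ ω ∂(P n), good n ω)
    (h : ∀ K : ℝ, Tendsto (fun p : Σ n, Ω n => Y p.1 p.2)
      (uniformFilter fun n ω => good n ω ∧ ‖X n ω‖ ≤ K) (𝓝 0)) :
    IsLittleOP P Y := by
  intro ε hε
  rw [ENNReal.tendsto_nhds_zero]
  intro δ hδ
  obtain ⟨δ', hδ', hδδ'⟩ : ∃ δ' : ℝ, 0 < δ' ∧ ENNReal.ofReal δ' ≤ δ := by
    rcases eq_or_ne δ ⊤ with rfl | hδt
    · exact ⟨1, one_pos, le_top⟩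
    · exact ⟨δ.toReal, ENNReal.toReal_pos hδ.ne' hδt, ENNReal.ofReal_toReal_le⟩
  obtain ⟨K, hK⟩ := hX δ' hδ'
  have h1 := eventually_uniformFilter.1
    ((tendsto_zero_iff_norm_tendsto_zero.1 (h K)).eventually_lt_const hε)
  filter_upwards [hgood, h1] with n hg hn
  refine le_trans (measure_mono_ae ?_) ((hK n).trans hδδ')
  filter_upwards [hg] with ω hω hYω
  by_contra hKω
  exact absurd (hn ω ⟨hω, not_lt.1 hKω⟩) (not_lt.2 hYω)

end UniformFilter

/-! ### Portmanteau, Slutsky and tightness on varying probability spaces -/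

section Convergence

variable {Ω : ℕ → Type*} [∀ n, MeasurableSpace (Ω n)] {P : ∀ n, Measure (Ω n)}
  [∀ n, IsProbabilityMeasure (P n)]
  {Ω' : Type*} [MeasurableSpace Ω'] {P' : Measure Ω'} [IsProbabilityMeasure P']

/-- Portmanteau: the closed set criterion for convergence in distribution. -/
theorem tendstoInDistribution_of_closed {F : Type*} [TopologicalSpace F] [MeasurableSpace F]
    [BorelSpace F] [HasOuterApproxClosed F] {Y : ∀ n, Ω n → F} {W : Ω' → F}
    (hY : ∀ n, AEMeasurable (Y n) (P n)) (hW : AEMeasurable W P')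
    (h : ∀ C : Set F, IsClosed C → ∀ ε : ENNReal, 0 < ε →
      ∀ᶠ n in atTop, P n (Y n ⁻¹' C) ≤ P' (W ⁻¹' C) + ε) :
    TendstoInDistribution Y atTop W P P' where
  forall_aemeasurable := hY
  aemeasurable_limit := hW
  tendsto := by
    have := fun n => Measure.isProbabilityMeasure_map (hY n)
    have := Measure.isProbabilityMeasure_map hW
    refine tendsto_of_forall_isOpen_le_liminf' fun G hG => ?_
    have key := (limsup_measure_closed_le_iff_liminf_measure_open_ge (L := atTop)
      (μ := P'.map W) (μs := fun n => (P n).map (Y n))).1 ?_ G hG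
    · exact key
    intro C hC
    refine ENNReal.le_of_forall_pos_le_add fun ε hε _ => ?_
    refine limsup_le_of_le (by isBoundedDefault) ?_
    filter_upwards [h C hC ε (by exact_mod_cast hε)] with n hn
    rwa [Measure.map_apply_of_aemeasurable (hY n) hC.measurableSet,
      Measure.map_apply_of_aemeasurable hW hC.measurableSet]

theorem _root_.MeasureTheory.TendstoInDistribution.eventually_closed_le {F : Type*} [TopologicalSpace F]
    [MeasurableSpace F]
    [BorelSpace F] [HasOuterApproxClosed F] {Y : ∀ n, Ω n → F} {W : Ω' → F}
    (h : TendstoInDistribution Y atTop W P P') {C : Set F} (hC : IsClosed C)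
    {ε : ENNReal} (hε : 0 < ε) :
    ∀ᶠ n in atTop, P n (Y n ⁻¹' C) ≤ P' (W ⁻¹' C) + ε := by
  have := fun n => Measure.isProbabilityMeasure_map (h.forall_aemeasurable n)
  have := Measure.isProbabilityMeasure_map h.aemeasurable_limit
  have h1 := ProbabilityMeasure.limsup_measure_closed_le_of_tendsto h.tendsto hC
  simp only [ProbabilityMeasure.coe_mk] at h1
  rw [Measure.map_apply_of_aemeasurable h.aemeasurable_limit hC.measurableSet] at h1
  have h2 : limsup (fun n => ((P n).map (Y n)) C) atTop < P' (W ⁻¹' C) + ε :=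
    h1.trans_lt (ENNReal.lt_add_right (measure_ne_top _ _) hε.ne')
  filter_upwards [eventually_lt_of_limsup_lt h2] with n hn
  rw [Measure.map_apply_of_aemeasurable (h.forall_aemeasurable n) hC.measurableSet] at hn
  exact hn.le

/-- A mapping principle: convergence in distribution is transferred along a relation between
closed sets. -/
theorem _root_.MeasureTheory.TendstoInDistribution.of_closed_relation {E F : Type*} [TopologicalSpace E]
    [MeasurableSpace E] [BorelSpace E] [HasOuterApproxClosed E]
    [TopologicalSpace F] [MeasurableSpace F] [BorelSpace F] [HasOuterApproxClosed F]
    {X : ∀ n, Ω n → E} {Z : Ω' → E} {Y : ∀ n, Ω n → F} {W : Ω' → F}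
    (h : TendstoInDistribution X atTop Z P P')
    (hY : ∀ n, AEMeasurable (Y n) (P n)) (hW : AEMeasurable W P')
    (hrel : ∀ C : Set F, IsClosed C → ∃ B : Set E, IsClosed B ∧
      (∀ᵐ ω ∂P', Z ω ∈ B → W ω ∈ C) ∧
      ∀ᶠ n in atTop, ∀ᵐ ω ∂(P n), Y n ω ∈ C → X n ω ∈ B) :
    TendstoInDistribution Y atTop W P P' := by
  refine tendstoInDistribution_of_closed hY hW fun C hC ε hε => ?_
  obtain ⟨B, hB, hZ, hn⟩ := hrel C hC
  filter_upwards [hn, h.eventually_closed_le hB hε] with n h1 h2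
  calc P n (Y n ⁻¹' C) ≤ P n (X n ⁻¹' B) := measure_mono_ae h1
    _ ≤ _ := h2
    _ ≤ _ := by gcongr ?_ + ε; exact measure_mono_ae hZ

/-- Only the law of the limit matters, so a limit variable may be traded for the identity on its
law; the next lemma is the converse exchange. -/
theorem _root_.MeasureTheory.TendstoInDistribution.of_hasLaw {E : Type*} [TopologicalSpace E]
    [MeasurableSpace E] [BorelSpace E] {X : ∀ n, Ω n → E} {Z : Ω' → E}
    (h : TendstoInDistribution X atTop Z P P') {μ : Measure E} [IsProbabilityMeasure μ]
    (hZ : HasLaw Z μ P') : TendstoInDistribution X atTop id P μ where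
  forall_aemeasurable := h.forall_aemeasurable
  aemeasurable_limit := aemeasurable_id
  tendsto := by
    have hμ : μ.map id = P'.map Z := by rw [Measure.map_id, hZ.map_eq]
    rw! [hμ]
    exact h.tendsto

theorem _root_.MeasureTheory.TendstoInDistribution.of_hasLaw' {E : Type*} [TopologicalSpace E]
    [MeasurableSpace E] [BorelSpace E] {X : ∀ n, Ω n → E} {Z : Ω' → E}
    {μ : Measure E} [IsProbabilityMeasure μ]
    (h : TendstoInDistribution X atTop id P μ)
    (hZ : HasLaw Z μ P') : TendstoInDistribution X atTop Z P P' where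
  forall_aemeasurable := h.forall_aemeasurable
  aemeasurable_limit := hZ.aemeasurable
  tendsto := by
    have hμ : μ.map id = P'.map Z := by rw [Measure.map_id, hZ.map_eq]
    rw! [← hμ]
    exact h.tendsto

/-- Slutsky's theorem for random variables living on varying probability spaces. -/
theorem _root_.MeasureTheory.TendstoInDistribution.of_isLittleOP_sub {E : Type*} [NormedAddCommGroup E]
    [MeasurableSpace E] [BorelSpace E]
    {X Y : ∀ n, Ω n → E} {Z : Ω' → E} (h : TendstoInDistribution X atTop Z P P')
    (hY : ∀ n, AEMeasurable (Y n) (P n)) (hXY : IsLittleOP P fun n ω => Y n ω - X n ω) :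
    TendstoInDistribution Y atTop Z P P' := by
  refine tendstoInDistribution_of_closed hY h.aemeasurable_limit fun C hC ε hε => ?_
  -- One third each for the convergence of `X` on a thickened set, for the event that `Y - X` is not
  -- small, and for the limit mass added by thickening.
  have hε2 : 0 < ε / 3 := ENNReal.div_pos hε.ne' (by simp)
  have hlim : Tendsto (fun δ => (P'.map Z) (Metric.cthickening δ C)) (𝓝 0)
      (𝓝 ((P'.map Z) C)) := by
    have := Measure.isProbabilityMeasure_map h.aemeasurable_limit
    exact tendsto_measure_cthickening_of_isClosed ⟨1, one_pos, measure_ne_top _ _⟩ hC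
  have hlt : (P'.map Z) C < (P'.map Z) C + ε / 3 := by
    have := Measure.isProbabilityMeasure_map h.aemeasurable_limit
    exact ENNReal.lt_add_right (measure_ne_top _ _) hε2.ne'
  obtain ⟨δ, hδ, hδ0⟩ := (((hlim.mono_left nhdsWithin_le_nhds).eventually_lt_const hlt).and
    (self_mem_nhdsWithin : Set.Ioi (0 : ℝ) ∈ 𝓝[>] 0)).exists
  rw [Measure.map_apply_of_aemeasurable h.aemeasurable_limit
      Metric.isClosed_cthickening.measurableSet,
    Measure.map_apply_of_aemeasurable h.aemeasurable_limit hC.measurableSet] at hδ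
  filter_upwards [h.eventually_closed_le
    (Metric.isClosed_cthickening (δ := δ) (E := C)) hε2,
    (hXY δ hδ0).eventually_lt_const hε2] with n h1 h2
  calc P n (Y n ⁻¹' C)
      ≤ P n (X n ⁻¹' Metric.cthickening δ C ∪ {ω | δ ≤ ‖Y n ω - X n ω‖}) := by
        refine measure_mono fun ω hω => ?_
        by_cases hd : δ ≤ ‖Y n ω - X n ω‖
        · exact Or.inr hd
        · refine Or.inl (Metric.mem_cthickening_of_dist_le _ _ _ _ hω ?_)
          rw [dist_comm, dist_eq_norm]
          exact (not_le.1 hd).le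
    _ ≤ P n (X n ⁻¹' Metric.cthickening δ C) + P n {ω | δ ≤ ‖Y n ω - X n ω‖} :=
        measure_union_le _ _
    _ ≤ (P' (Z ⁻¹' Metric.cthickening δ C) + ε / 3) + ε / 3 := by gcongr
    _ ≤ (P' (Z ⁻¹' C) + ε / 3 + ε / 3) + ε / 3 := by gcongr
    _ = _ := by rw [add_assoc, add_assoc, ← add_assoc (ε / 3), ENNReal.add_thirds]

theorem exists_measure_norm_gt_le {Ω₀ E : Type*} [MeasurableSpace Ω₀] {μ : Measure Ω₀}
    [IsProbabilityMeasure μ] [NormedAddCommGroup E] [MeasurableSpace E] [BorelSpace E]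
    {Y : Ω₀ → E} (hY : AEMeasurable Y μ) {ε : ENNReal} (hε : 0 < ε) :
    ∃ M : ℕ, μ {ω | (M : ℝ) < ‖Y ω‖} < ε := by
  have hanti : Antitone fun M : ℕ => {ω | (M : ℝ) < ‖Y ω‖} := fun a b hab ω hω =>
    lt_of_le_of_lt (Nat.cast_le.2 hab) (show (b : ℝ) < ‖Y ω‖ from hω)
  have h0 : ⋂ M : ℕ, {ω | (M : ℝ) < ‖Y ω‖} = ∅ := by
    refine Set.eq_empty_of_forall_notMem fun ω hω => ?_
    obtain ⟨M, hM⟩ := exists_nat_gt ‖Y ω‖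
    exact lt_asymm hM (Set.mem_iInter.1 hω M)
  have hlim := tendsto_measure_iInter_atTop (μ := μ)
    (fun M : ℕ => nullMeasurableSet_lt (aemeasurable_const (b := (M : ℝ))) hY.norm) hanti
    ⟨0, measure_ne_top _ _⟩
  rw [h0, measure_empty] at hlim
  exact (hlim.eventually_lt_const hε).exists

/-- `IsBigOP` asks for one bound valid for every `n`; each of the finitely many early variables is
tight by itself. -/
theorem isBigOP_of_eventually {E : Type*} [NormedAddCommGroup E] [MeasurableSpace E]
    [BorelSpace E] {Y : ∀ n, Ω n → E} (hY : ∀ n, AEMeasurable (Y n) (P n))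
    (h : ∀ ε : ℝ, 0 < ε → ∃ M : ℝ, ∀ᶠ n in atTop, P n {ω | M < ‖Y n ω‖} ≤ ENNReal.ofReal ε) :
    IsBigOP P Y := by
  intro ε hε
  obtain ⟨M, hM⟩ := h ε hε
  obtain ⟨N, hN⟩ := eventually_atTop.1 hM
  choose m hm using fun n => exists_measure_norm_gt_le (hY n) (ENNReal.ofReal_pos.2 hε)
  refine ⟨max M (∑ n ∈ Finset.range N, (m n : ℝ)), fun n => ?_⟩
  rcases le_or_gt N n with hn | hn
  · refine (measure_mono fun ω hω => ?_).trans (hN n hn)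
    rw [Set.mem_ofPred_eq] at hω ⊢
    exact (le_max_left _ _).trans_lt hω
  · refine (measure_mono fun ω hω => ?_).trans (hm n).le
    rw [Set.mem_ofPred_eq] at hω ⊢
    refine lt_of_le_of_lt (le_max_of_le_right ?_) hω
    exact Finset.single_le_sum (f := fun n => (m n : ℝ)) (fun i _ => Nat.cast_nonneg _)
      (Finset.mem_range.2 hn)

theorem _root_.MeasureTheory.TendstoInDistribution.isBigOP {E : Type*} [NormedAddCommGroup E] [MeasurableSpace E]
    [BorelSpace E] {X : ∀ n, Ω n → E} {Z : Ω' → E} (h : TendstoInDistribution X atTop Z P P') :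
    IsBigOP P X := by
  refine isBigOP_of_eventually h.forall_aemeasurable fun ε hε => ?_
  have hε2 : 0 < ENNReal.ofReal ε / 2 := ENNReal.div_pos (ENNReal.ofReal_pos.2 hε).ne' (by simp)
  obtain ⟨M, hM⟩ := exists_measure_norm_gt_le h.aemeasurable_limit hε2
  -- The gap between `M` and `M + 1` leaves room for a closed set between the two strict tails, as
  -- portmanteau requires.
  refine ⟨M + 1, ?_⟩
  have hC : IsClosed {x : E | (M : ℝ) + 1 ≤ ‖x‖} := isClosed_le continuous_const continuous_norm
  filter_upwards [h.eventually_closed_le hC hε2] with n hn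
  calc P n {ω | (M : ℝ) + 1 < ‖X n ω‖} ≤ P n (X n ⁻¹' {x : E | (M : ℝ) + 1 ≤ ‖x‖}) :=
        measure_mono fun ω hω => (show (M : ℝ) + 1 < ‖X n ω‖ from hω).le
    _ ≤ _ := hn
    _ ≤ P' {ω | (M : ℝ) < ‖Z ω‖} + ENNReal.ofReal ε / 2 := by
        gcongr
        intro ω hω
        exact (lt_add_one _).trans_le (show (M : ℝ) + 1 ≤ ‖Z ω‖ from hω)
    _ ≤ ENNReal.ofReal ε / 2 + ENNReal.ofReal ε / 2 := by gcongr
    _ = _ := ENNReal.add_halves _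

theorem isBigOP_of_norm_le {E F : Type*} [Norm E] [NormedAddCommGroup F] [MeasurableSpace F]
    [BorelSpace F] {X : ∀ n, Ω n → E} {Y : ∀ n, Ω n → F} (hX : IsBigOP P X)
    (hY : ∀ n, AEMeasurable (Y n) (P n))
    (h : ∀ᶠ n in atTop, ∀ᵐ ω ∂(P n), ‖Y n ω‖ ≤ ‖X n ω‖) : IsBigOP P Y := by
  refine isBigOP_of_eventually hY fun ε hε => ?_
  obtain ⟨M, hM⟩ := hX ε hε
  refine ⟨M, ?_⟩
  filter_upwards [h] with n hn
  refine le_trans (measure_mono_ae ?_) (hM n)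
  filter_upwards [hn] with ω hω hYω
  exact lt_of_lt_of_le hYω hω

end Convergence

/-! ### Central limit theorem for row arrays and Gaussian moments -/

section CentralLimit

open scoped RealInnerProductSpace

/-- The Cramér–Wold reduction: along a line the characteristic function is that of a real
projection. -/
theorem charFun_smul_eq_charFun_map_inner {E : Type*} [NormedAddCommGroup E]
    [InnerProductSpace ℝ E] [MeasurableSpace E] [BorelSpace E] (μ : Measure E) (s : ℝ) (t : E) :
    charFun μ (s • t) = charFun (μ.map fun x => ⟪x, t⟫) s := by
  have hm : Continuous fun x : E => ⟪x, t⟫ := by fun_prop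
  rw [charFun_apply, charFun_apply, integral_map hm.measurable.aemeasurable (by fun_prop)]
  simp [real_inner_smul_right, mul_comm]

/-- The central limit theorem for the rows of a triangular array of independent vectors with a
common law. -/
theorem tendstoInDistribution_inv_sqrt_smul_sum
    {Ω : ℕ → Type*} [∀ n, MeasurableSpace (Ω n)] {P : ∀ n, Measure (Ω n)}
    [∀ n, IsProbabilityMeasure (P n)] {E : Type*} [NormedAddCommGroup E]
    [InnerProductSpace ℝ E] [FiniteDimensional ℝ E] [MeasurableSpace E] [BorelSpace E]
    {ξ : ∀ n, Fin n → Ω n → E} (hind : ∀ n, iIndepFun (ξ n) (P n)) {μ ν : Measure E}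
    [IsProbabilityMeasure μ] [IsProbabilityMeasure ν]
    (hlaw : ∀ n i, HasLaw (ξ n i) μ (P n)) (h0 : ∀ t, ∫ x, ⟪x, t⟫ ∂μ = 0) {Q : E → ℝ}
    (hint : ∀ t, Integrable (fun x => ⟪x, t⟫ ^ 2) μ) (hQ : ∀ t, ∫ x, ⟪x, t⟫ ^ 2 ∂μ = Q t)
    (hν : ∀ t, charFun ν t = Complex.exp (-(Q t : ℂ) / 2)) :
    TendstoInDistribution (fun (n : ℕ) ω => (√(n : ℝ))⁻¹ • ∑ i, ξ n i ω) atTop id P ν where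
  forall_aemeasurable n := by
    have := fun i => (hlaw n i).aemeasurable
    fun_prop
  aemeasurable_limit := aemeasurable_id
  tendsto := by
    refine ProbabilityMeasure.tendsto_iff_tendsto_charFun.2 fun t => ?_
    have hm : Continuous fun x : E => ⟪x, t⟫ := by fun_prop
    have hrow : ∀ n, charFun ((P n).map fun ω => (√(n : ℝ))⁻¹ • ∑ i, ξ n i ω) t =
        charFun (μ.map fun x => ⟪x, t⟫) (√(n : ℝ))⁻¹ ^ n := by
      intro n
      have hae := fun i => (hlaw n i).aemeasurable
      rw [charFun_map_smul_comp (by fun_prop), (hind n).charFun_map_fun_sum_eq_prod hae]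
      simp [fun i => (hlaw n i).map_eq, charFun_smul_eq_charFun_map_inner]
    rw! [Measure.map_id]
    simp only [ProbabilityMeasure.coe_mk]
    simp_rw [hrow, hν]
    have hQ0 : 0 ≤ Q t := by rw [← hQ]; positivity
    -- A direction of zero variance has to be separated: there the projection is almost surely zero
    -- and cannot be standardized.
    rcases hQ0.eq_or_lt with h | h
    · have hz : (fun x : E => ⟪x, t⟫) =ᵐ[μ] 0 := by
        have := (integral_eq_zero_iff_of_nonneg (fun x => sq_nonneg _) (hint t)).1
          ((hQ t).trans h.symm)
        filter_upwards [this] with x hx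
        simpa using hx
      rw [Measure.map_congr hz]
      have h1 : ∀ s : ℝ, charFun (μ.map (0 : E → ℝ)) s = 1 := by
        intro s
        rw [charFun_apply, integral_map (by fun_prop) (by fun_prop)]
        simp
      simp [h1, ← h]
    · have hσ : 0 < √(Q t) := Real.sqrt_pos.2 h
      -- The projection is scaled to unit variance and the scalar theorem is evaluated at `√(Q t)`,
      -- which undoes the scaling.
      have key := tendsto_charFun_inv_sqrt_mul_pow (P := μ)
        (X := fun x => (√(Q t))⁻¹ * ⟪x, t⟫) (by fun_prop)
        (by rw [integral_const_mul, h0, mul_zero])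
        (by
          simp only [Pi.pow_apply, mul_pow]
          rw [integral_const_mul, hQ, inv_pow, Real.sq_sqrt hQ0, inv_mul_cancel₀ h.ne'])
        (√(Q t))
      have h2 : ∀ s : ℝ, charFun (μ.map fun x => (√(Q t))⁻¹ * ⟪x, t⟫) (s * √(Q t)) =
          charFun (μ.map fun x => ⟪x, t⟫) s := by
        intro s
        rw [charFun_map_mul_comp (by fun_prop)]
        congr 1
        field_simp
      simp_rw [h2] at key
      convert key using 3
      rw [← Complex.ofReal_pow, Real.sq_sqrt hQ0]

theorem integral_pow_four_gaussianReal : ∫ x, x ^ 4 ∂(gaussianReal 0 1) = 3 := by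
  have h := iteratedDeriv_mgf_zero (X := id) (μ := gaussianReal 0 1) (by simp) 4
  rw [mgf_id_gaussianReal] at h
  have key : iteratedDeriv 4 (fun t : ℝ => Real.exp (0 * t + ((1 : NNReal) : ℝ) * t ^ 2 / 2)) 0
      = 3 := by
    -- Differentiation keeps the shape polynomial times `exp (t² / 2)`, sending `f` to `f' + t f`;
    -- four applications give the fourth moment.
    have hd : ∀ (f f' : ℝ → ℝ), (∀ x, HasDerivAt f (f' x) x) →
        deriv (fun t => f t * Real.exp (t ^ 2 / 2)) =
          fun t => (f' t + t * f t) * Real.exp (t ^ 2 / 2) := by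
      intro f f' hf
      funext x
      have h1 : HasDerivAt (fun t : ℝ => t ^ 2 / 2) x x := by
        simpa using (hasDerivAt_pow 2 x).div_const 2
      exact ((hf x).mul h1.exp).deriv.trans (by ring)
    have e0 : (fun t : ℝ => Real.exp (0 * t + ((1 : NNReal) : ℝ) * t ^ 2 / 2)) =
        fun t => (fun _ => (1 : ℝ)) t * Real.exp (t ^ 2 / 2) := by
      funext t; simp
    rw [e0]
    simp only [iteratedDeriv_succ, iteratedDeriv_zero]
    rw [hd _ (fun _ => 0) fun x => hasDerivAt_const x _]
    rw [hd (fun t => 0 + t * 1) (fun _ => 1) fun x => by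
      simpa using hasDerivAt_id' x]
    rw [hd (fun t => 1 + t * (0 + t * 1)) (fun t => 2 * t) fun x => by
      simpa [← pow_two] using (hasDerivAt_pow 2 x).const_add 1]
    rw [hd (fun t => 2 * t + t * (1 + t * (0 + t * 1))) (fun t => 3 + 3 * t ^ 2) fun x => by
      have h3 : HasDerivAt (fun t : ℝ => 3 * t + t ^ 3) (3 * 1 + 3 * x ^ 2) x := by
        simpa using! ((hasDerivAt_id' x).const_mul 3).add (hasDerivAt_pow 3 x)
      convert h3 using 1
      · funext t; ring
      · ring]
    simp
  rw [key] at h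
  simpa using h.symm

theorem memLp_sq_gaussianReal : MemLp (fun x : ℝ => x ^ 2) 2 (gaussianReal 0 1) := by
  rw [memLp_two_iff_integrable_sq (by fun_prop)]
  have := (memLp_id_gaussianReal (μ := 0) (v := 1) 4).integrable_norm_pow (by norm_num)
  refine this.congr (ae_of_all _ fun x => ?_)
  simp only [id, Real.norm_eq_abs]
  rw [← pow_mul]
  exact (even_two_mul 2).pow_abs x

theorem integral_sq_gaussianReal : ∫ x, x ^ 2 ∂(gaussianReal 0 1) = 1 := by
  have h := variance_id_gaussianReal (μ := 0) (v := 1)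
  rw [variance_of_integral_eq_zero (by fun_prop) (by simp)] at h
  simpa using h

theorem variance_sq_gaussianReal : Var[fun x => x ^ 2; gaussianReal 0 1] = 2 := by
  rw [variance_eq_sub memLp_sq_gaussianReal]
  simp only [Pi.pow_apply, ← pow_mul, integral_sq_gaussianReal]
  norm_num [integral_pow_four_gaussianReal]

end CentralLimit

/-! ### Mean and variance of Gaussian quadratic forms -/

section QuadraticForm

open scoped RealInnerProductSpace

theorem pi_gaussianReal_sum_sq {p : ℕ} (c : Fin p → ℝ) :
    MemLp (fun y : Fin p → ℝ => ∑ i, c i * y i ^ 2) 2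
        (Measure.pi fun _ : Fin p => gaussianReal 0 1) ∧
      ∫ y, ∑ i, c i * y i ^ 2 ∂(Measure.pi fun _ : Fin p => gaussianReal 0 1) = ∑ i, c i ∧
      Var[fun y : Fin p → ℝ => ∑ i, c i * y i ^ 2; Measure.pi fun _ : Fin p => gaussianReal 0 1] =
        2 * ∑ i, c i ^ 2 := by
  have hL : ∀ i, MemLp (fun x : ℝ => c i * x ^ 2) 2 (gaussianReal 0 1) := fun i =>
    memLp_sq_gaussianReal.const_mul (c i)
  have hL' : ∀ i, MemLp (fun y : Fin p → ℝ => c i * y i ^ 2) 2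
      (Measure.pi fun _ : Fin p => gaussianReal 0 1) := fun i =>
    (hL i).comp_measurePreserving (measurePreserving_eval (fun _ : Fin p => gaussianReal 0 1) i)
  refine ⟨memLp_finsetSum _ fun i _ => hL' i, ?_, ?_⟩
  · rw [integral_finsetSum _ fun i _ => (hL' i).integrable (by norm_num)]
    refine Finset.sum_congr rfl fun i _ => ?_
    have := integral_comp_eval (μ := fun _ : Fin p => gaussianReal 0 1) (i := i)
      (f := fun x : ℝ => c i * x ^ 2) (by fun_prop)
    rw [this, integral_const_mul, integral_sq_gaussianReal, mul_one]
  · have h := variance_sum_pi (μ := fun _ : Fin p => gaussianReal 0 1) hL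
    rw [show (∑ i, fun ω : Fin p → ℝ => c i * ω i ^ 2) = fun y => ∑ i, c i * y i ^ 2 by
      ext y; simp] at h
    rw [h, Finset.mul_sum]
    refine Finset.sum_congr rfl fun i _ => ?_
    rw [variance_const_mul, variance_sq_gaussianReal, mul_comm]

/-- Mean and variance of a quadratic form in standard Gaussian variables. -/
theorem stdGaussian_quadratic {p : ℕ} {A : Matrix (Fin p) (Fin p) ℝ} (hA : A.IsHermitian) :
    MemLp (fun x : EuclideanSpace ℝ (Fin p) => x.ofLp ⬝ᵥ A *ᵥ x.ofLp - A.trace) 2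
        (stdGaussian (EuclideanSpace ℝ (Fin p))) ∧
      ∫ x, (x.ofLp ⬝ᵥ A *ᵥ x.ofLp - A.trace) ∂(stdGaussian (EuclideanSpace ℝ (Fin p))) = 0 ∧
      ∫ x, (x.ofLp ⬝ᵥ A *ᵥ x.ofLp - A.trace) ^ 2 ∂(stdGaussian (EuclideanSpace ℝ (Fin p))) =
        2 * (A * A).trace := by
  obtain ⟨U, c, hUU, hAU⟩ : ∃ (U : Matrix (Fin p) (Fin p) ℝ) (c : Fin p → ℝ),
      Uᵀ * U = 1 ∧ A = U * Matrix.diagonal c * Uᵀ := by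
    refine ⟨hA.eigenvectorUnitary, hA.eigenvalues, ?_, ?_⟩
    · simpa [Matrix.star_eq_conjTranspose, Matrix.conjTranspose_eq_transpose_of_trivial]
        using Unitary.coe_star_mul_self hA.eigenvectorUnitary
    · conv_lhs => rw [hA.spectral_theorem, Unitary.conjStarAlgAut_apply]
      simp [Matrix.star_eq_conjTranspose, Matrix.conjTranspose_eq_transpose_of_trivial]
  have hUU' : U * Uᵀ = 1 := mul_eq_one_comm.1 hUU
  -- Rotation invariance: in an eigenbasis of `A` the form is a weighted sum of squares of
  -- independent standard normals.
  have hlaw : stdGaussian (EuclideanSpace ℝ (Fin p)) =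
      (Measure.pi fun _ : Fin p => gaussianReal 0 1).map
        fun y => WithLp.toLp 2 (U *ᵥ y) := by
    let f : EuclideanSpace ℝ (Fin p) ≃ₗᵢ[ℝ] EuclideanSpace ℝ (Fin p) :=
      LinearIsometryEquiv.ofSurjective
        (LinearIsometry.mk (Matrix.toEuclideanLin U) fun x => by
          rw [← sq_eq_sq₀ (norm_nonneg _) (norm_nonneg _), EuclideanSpace.real_norm_sq_eq,
            EuclideanSpace.real_norm_sq_eq]
          have h1 : (U *ᵥ x.ofLp) ⬝ᵥ (U *ᵥ x.ofLp) = x.ofLp ⬝ᵥ x.ofLp := by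
            rw [Matrix.dotProduct_mulVec, ← Matrix.mulVec_transpose, Matrix.mulVec_mulVec, hUU,
              Matrix.one_mulVec]
          simpa [dotProduct, pow_two] using h1)
        fun x => ⟨WithLp.toLp 2 (Uᵀ *ᵥ x.ofLp), by
          simp [Matrix.toLpLin_apply, Matrix.mulVec_mulVec, hUU']⟩
    rw [← stdGaussian_map f, ← map_pi_eq_stdGaussian, Measure.map_map (by fun_prop) (by fun_prop)]
    rfl
  have htr : A.trace = ∑ i, c i := by
    rw [hAU, Matrix.trace_mul_comm, ← Matrix.mul_assoc, hUU, Matrix.one_mul,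
      Matrix.trace_diagonal]
  have htr2 : (A * A).trace = ∑ i, c i ^ 2 := by
    have : A * A = U * (Matrix.diagonal c * Matrix.diagonal c * Uᵀ) := by
      rw [hAU]
      calc _ = U * Matrix.diagonal c * (Uᵀ * U) * Matrix.diagonal c * Uᵀ := by
            simp only [Matrix.mul_assoc]
        _ = _ := by rw [hUU]; simp only [Matrix.mul_assoc, Matrix.mul_one]
    rw [this, Matrix.trace_mul_comm, Matrix.mul_assoc, hUU, Matrix.mul_one,
      Matrix.diagonal_mul_diagonal, Matrix.trace_diagonal]
    simp [pow_two]
  have hq : ∀ y : Fin p → ℝ, (U *ᵥ y) ⬝ᵥ A *ᵥ (U *ᵥ y) = ∑ i, c i * y i ^ 2 := by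
    intro y
    rw [Matrix.mulVec_mulVec, Matrix.dotProduct_mulVec, Matrix.vecMul_mulVec, hAU]
    have : Uᵀ * (U * Matrix.diagonal c * Uᵀ * U) = Matrix.diagonal c := by
      calc _ = (Uᵀ * U) * Matrix.diagonal c * (Uᵀ * U) := by simp only [Matrix.mul_assoc]
        _ = _ := by rw [hUU, Matrix.one_mul, Matrix.mul_one]
    rw [← Matrix.dotProduct_mulVec, this]
    simp only [dotProduct, Matrix.mulVec_diagonal]
    exact Finset.sum_congr rfl fun i _ => by ring
  obtain ⟨h1, h2, h3⟩ := pi_gaussianReal_sum_sq c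
  have hm : Measurable fun y : Fin p → ℝ => (WithLp.toLp 2 (U *ᵥ y) : EuclideanSpace ℝ (Fin p)) := by
    refine Continuous.measurable ?_
    fun_prop
  have hc : Continuous fun x : EuclideanSpace ℝ (Fin p) => x.ofLp ⬝ᵥ A *ᵥ x.ofLp - A.trace := by
    fun_prop
  have hc2 : Continuous fun x : EuclideanSpace ℝ (Fin p) =>
      (x.ofLp ⬝ᵥ A *ᵥ x.ofLp - A.trace) ^ 2 := hc.pow 2
  rw [hlaw, memLp_map_measure_iff hc.aestronglyMeasurable hm.aemeasurable,
    integral_map hm.aemeasurable hc.aestronglyMeasurable,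
    integral_map hm.aemeasurable hc2.aestronglyMeasurable, htr, htr2]
  simp only [Function.comp_def, hq]
  refine ⟨h1.sub (memLp_const _), ?_, ?_⟩
  · rw [integral_sub (h1.integrable (by norm_num)) (integrable_const _), h2]
    simp
  · rw [← h3, variance_eq_integral h1.aestronglyMeasurable.aemeasurable, h2]

end QuadraticForm

/-! ### Vectorization and the commutation matrix -/

section Vec

theorem vecE_apply {m n : Type*} (A : Matrix m n ℝ) (a : n × m) : vecE A a = A a.2 a.1 := rfl

theorem continuous_vecE {m n : Type*} : Continuous (vecE : Matrix m n ℝ → _) := by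
  unfold vecE Matrix.vec
  fun_prop

theorem aemeasurable_vecE {Ω₀ m n : Type*} [Fintype m] [Fintype n] [MeasurableSpace Ω₀]
    {μ : Measure Ω₀} {M : Ω₀ → Matrix m n ℝ} :
    AEMeasurable (fun ω => vecE (M ω)) μ ↔ ∀ i j, AEMeasurable (fun ω => M ω i j) μ := by
  constructor
  · intro h i j
    have : Measurable fun x : EuclideanSpace ℝ (n × m) => x (j, i) := by fun_prop
    exact this.comp_aemeasurable h
  · intro h
    unfold vecE
    have : AEMeasurable (fun ω => (M ω).vec) μ := aemeasurable_pi_lambda _ fun a => h a.2 a.1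
    fun_prop

theorem tendsto_vecE_zero {α m n : Type*} {l : Filter α} {M : α → Matrix m n ℝ}
    [Fintype m] [Fintype n]
    (h : ∀ i j, Tendsto (fun a => M a i j) l (𝓝 0)) : Tendsto (fun a => vecE (M a)) l (𝓝 0) := by
  have h1 : Tendsto M l (𝓝 0) := tendsto_pi_nhds.2 fun i => tendsto_pi_nhds.2 fun j => h i j
  have h2 := (continuous_vecE (m := m) (n := n)).tendsto 0
  have h3 : vecE (0 : Matrix m n ℝ) = 0 := by ext; rfl
  rw [h3] at h2
  exact h2.comp h1

theorem abs_apply_le_norm_vecE {m n : Type*} [Fintype m] [Fintype n] (A : Matrix m n ℝ) (i : m)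
    (j : n) : |A i j| ≤ ‖vecE A‖ := by
  have := PiLp.norm_apply_le (vecE A) (j, i)
  simpa [vecE_apply] using this

theorem tendsto_toLp_zero {α ι : Type*} {l : Filter α} [Fintype ι]
    {f : α → ι → ℝ} (h : ∀ i, Tendsto (fun a => f a i) l (𝓝 0)) :
    Tendsto (fun a => (WithLp.toLp 2 (f a) : EuclideanSpace ℝ ι)) l (𝓝 0) := by
  have h2 := (PiLp.continuous_toLp 2 (fun _ : ι => ℝ)).tendsto 0
  exact h2.comp (tendsto_pi_nhds.2 h)

theorem one_add_commutationMatrix_mulVec (p : ℕ) (t : Fin p × Fin p → ℝ) :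
    (1 + commutationMatrix p) *ᵥ t = fun a => t a + t a.swap := by
  rw [Matrix.add_mulVec, Matrix.one_mulVec]
  have h := commutationMatrix_mulVec_vec p (Matrix.of fun i j => t (j, i))
  have h1 : (Matrix.of fun i j => t (j, i)).vec = t := rfl
  rw [h1] at h
  rw [h]
  rfl

/-- Reindexing by the swap symmetrizes the form; written as a sum of squares it is visibly
nonnegative and ready for Cauchy–Schwarz. -/
theorem dotProduct_one_add_commutationMatrix (p : ℕ) (t : Fin p × Fin p → ℝ) :
    t ⬝ᵥ (1 + commutationMatrix p) *ᵥ t = 2⁻¹ * ∑ a, (t a + t a.swap) ^ 2 := by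
  rw [one_add_commutationMatrix_mulVec, dotProduct]
  have h : ∑ a : Fin p × Fin p, t a.swap * (t a + t a.swap) = ∑ a, t a * (t a + t a.swap) := by
    refine Fintype.sum_equiv (Equiv.prodComm _ _) _ _ fun a => ?_
    simp [add_comm]
  have h2 : ∑ a, (t a + t a.swap) ^ 2 =
      ∑ a, t a * (t a + t a.swap) + ∑ a, t a.swap * (t a + t a.swap) := by
    rw [← Finset.sum_add_distrib]
    exact Finset.sum_congr rfl fun a _ => by ring
  rw [h2, h]
  ring

theorem posSemidef_one_add_commutationMatrix (p : ℕ) : (1 + commutationMatrix p).PosSemidef := by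
  refine Matrix.PosSemidef.of_dotProduct_mulVec_nonneg ?_ fun t => ?_
  · ext a b
    simp only [commutationMatrix, Matrix.conjTranspose_apply, Matrix.add_apply, Matrix.of_apply,
      Matrix.one_apply, star_trivial]
    congr 1
    · simp [eq_comm]
    · congr 1
      exact propext ⟨fun h => by rw [h, Prod.swap_swap], fun h => by rw [h, Prod.swap_swap]⟩
  · rw [star_trivial, dotProduct_one_add_commutationMatrix]
    positivity

end Vec

/-! ### Linear images of Gaussian vectors -/

section Laws

open scoped RealInnerProductSpace

/-- A linear image of a centered Gaussian vector is a centered Gaussian vector. -/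
theorem hasLaw_multivariateGaussian_comp {Ω₀ ι κ : Type*} [MeasurableSpace Ω₀] {μ : Measure Ω₀}
    [Fintype ι] [Fintype κ] [DecidableEq ι] [DecidableEq κ]
    {S : Matrix ι ι ℝ} {S' : Matrix κ κ ℝ} (hS : S.PosSemidef) (hS' : S'.PosSemidef)
    {Y : Ω₀ → EuclideanSpace ℝ ι} (hY : HasLaw Y (multivariateGaussian 0 S) μ)
    {L : EuclideanSpace ℝ ι → EuclideanSpace ℝ κ} (hL : Continuous L)
    (M : EuclideanSpace ℝ κ → EuclideanSpace ℝ ι) (hLM : ∀ x t, ⟪L x, t⟫ = ⟪x, M t⟫)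
    (hSM : ∀ t, (M t).ofLp ⬝ᵥ S *ᵥ (M t).ofLp = t.ofLp ⬝ᵥ S' *ᵥ t.ofLp) :
    HasLaw (fun ω => L (Y ω)) (multivariateGaussian 0 S') μ := by
  refine HasLaw.fun_comp (Y := L) (μ := multivariateGaussian 0 S) ⟨by fun_prop, ?_⟩ hY
  have := Measure.isProbabilityMeasure_map (μ := multivariateGaussian 0 S) hL.measurable.aemeasurable
  refine Measure.ext_of_charFun (funext fun t => ?_)
  rw [charFun_apply, integral_map hL.measurable.aemeasurable (by fun_prop)]
  simp_rw [hLM]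
  rw [← charFun_apply, charFun_multivariateGaussian hS, charFun_multivariateGaussian hS']
  simp only [inner_zero_right]
  rw [hSM]

end Laws

/-! ### Central limit theorem for the sample covariance matrix -/

section SampleCovariance

open scoped RealInnerProductSpace

variable {p : ℕ}

theorem sampleCov_apply {n : ℕ} (x : Fin n → EuclideanSpace ℝ (Fin p)) (a b : Fin p) :
    sampleCov x a b = (n : ℝ)⁻¹ * ∑ i, (x i a - sampleMean x a) * (x i b - sampleMean x b) := by
  simp [sampleCov, Matrix.sum_apply, Matrix.vecMulVec_apply]

theorem sampleMean_apply {n : ℕ} (x : Fin n → EuclideanSpace ℝ (Fin p)) (a : Fin p) :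
    sampleMean x a = (n : ℝ)⁻¹ * ∑ i, x i a := by
  simp [sampleMean]

theorem sampleCov_apply_eq {n : ℕ} (hn : n ≠ 0) (x : Fin n → EuclideanSpace ℝ (Fin p))
    (a b : Fin p) :
    sampleCov x a b = (n : ℝ)⁻¹ * ∑ i, x i a * x i b - sampleMean x a * sampleMean x b := by
  have hn' : (n : ℝ) ≠ 0 := Nat.cast_ne_zero.2 hn
  rw [sampleCov_apply]
  have h : ∑ i, (x i a - sampleMean x a) * (x i b - sampleMean x b) =
      ∑ i, x i a * x i b - (∑ i, x i a) * sampleMean x b - sampleMean x a * (∑ i, x i b)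
        + n * (sampleMean x a * sampleMean x b) := by
    simp_rw [sub_mul, mul_sub, Finset.sum_sub_distrib, Finset.sum_mul, Finset.mul_sum]
    simp
    ring
  rw [h, sampleMean_apply, sampleMean_apply]
  field_simp
  ring

/-- Since `x x' - I` is symmetric, it only sees the symmetric part of `t`; the pairing becomes a
centered quadratic form with symmetric matrix. -/
theorem inner_vecE_vecMulVec_sub_one (x : EuclideanSpace ℝ (Fin p))
    (t : EuclideanSpace ℝ (Fin p × Fin p)) :
    ⟪vecE (Matrix.vecMulVec x.ofLp x.ofLp - 1), t⟫ =
      x.ofLp ⬝ᵥ (Matrix.of fun i j => (t (i, j) + t (j, i)) / 2) *ᵥ x.ofLp -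
        (Matrix.of fun i j => (t (i, j) + t (j, i)) / 2).trace := by
  have h1 : ⟪vecE (Matrix.vecMulVec x.ofLp x.ofLp - 1), t⟫ =
      ∑ i, ∑ j, t (i, j) * (x i * x j - if i = j then 1 else 0) := by
    rw [PiLp.inner_apply, Fintype.sum_prod_type]
    refine Finset.sum_congr rfl fun i _ => Finset.sum_congr rfl fun j _ => ?_
    simp [vecE_apply, Matrix.vecMulVec_apply, Matrix.one_apply, eq_comm, mul_comm]
  have h2 : ∑ i, ∑ j, t (i, j) * (x i * x j - if i = j then 1 else 0) =
      ∑ i, ∑ j, t (j, i) * (x i * x j - if i = j then 1 else 0) := by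
    rw [Finset.sum_comm]
    refine Finset.sum_congr rfl fun i _ => Finset.sum_congr rfl fun j _ => ?_
    simp [eq_comm, mul_comm]
  have h3 : ⟪vecE (Matrix.vecMulVec x.ofLp x.ofLp - 1), t⟫ =
      ∑ i, ∑ j, (t (i, j) + t (j, i)) / 2 * (x i * x j - if i = j then 1 else 0) := by
    rw [← add_self_div_two ⟪vecE (Matrix.vecMulVec x.ofLp x.ofLp - 1), t⟫]
    conv_lhs => rw [h1]; enter [1, 2]; rw [h2]
    rw [← Finset.sum_add_distrib, Finset.sum_div]
    refine Finset.sum_congr rfl fun i _ => ?_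
    rw [← Finset.sum_add_distrib, Finset.sum_div]
    exact Finset.sum_congr rfl fun j _ => by ring
  rw [h3]
  simp only [dotProduct, Matrix.mulVec, Matrix.of_apply, Matrix.trace, Matrix.diag,
    Finset.mul_sum, mul_sub, Finset.sum_sub_distrib, mul_ite, mul_one, mul_zero,
    Finset.sum_ite_eq, Finset.mem_univ, if_true]
  congr 1
  exact Finset.sum_congr rfl fun i _ => Finset.sum_congr rfl fun j _ => by ring

variable {Ω : ℕ → Type*} [∀ n, MeasurableSpace (Ω n)] {P : ∀ n, Measure (Ω n)}
  [∀ n, IsProbabilityMeasure (P n)]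

theorem integral_inner_stdGaussian_sq {E : Type*} [NormedAddCommGroup E]
    [InnerProductSpace ℝ E] [FiniteDimensional ℝ E] [MeasurableSpace E] [BorelSpace E] (t : E) :
    Integrable (fun x => ⟪x, t⟫ ^ 2) (stdGaussian E) ∧ ∫ x, ⟪x, t⟫ ∂(stdGaussian E) = 0 ∧
      ∫ x, ⟪x, t⟫ ^ 2 ∂(stdGaussian E) = ‖t‖ ^ 2 := by
  have hL : MemLp (fun x : E => ⟪x, t⟫) 2 (stdGaussian E) :=
    (IsGaussian.memLp_two_id (μ := stdGaussian E)).inner_const t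
  have h0 : ∫ x, ⟪x, t⟫ ∂(stdGaussian E) = 0 := by
    have := integral_strongDual_stdGaussian (innerSL ℝ t)
    simpa [real_inner_comm] using this
  refine ⟨hL.integrable_sq, h0, ?_⟩
  have h := variance_dual_stdGaussian (innerSL ℝ t)
  rw [innerSL_apply_norm] at h
  rw [← h, variance_of_integral_eq_zero (by fun_prop)]
  · simp [real_inner_comm]
  · simpa [real_inner_comm] using h0

theorem tendstoInDistribution_inv_sqrt_smul_sum_stdGaussian
    {U : ∀ n, Fin n → Ω n → EuclideanSpace ℝ (Fin p)} (hind : ∀ n, iIndepFun (U n) (P n))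
    (hlaw : ∀ n i, HasLaw (U n i) (stdGaussian (EuclideanSpace ℝ (Fin p))) (P n)) :
    TendstoInDistribution (fun (n : ℕ) ω => (√(n : ℝ))⁻¹ • ∑ i, U n i ω) atTop id P
      (stdGaussian (EuclideanSpace ℝ (Fin p))) := by
  refine tendstoInDistribution_inv_sqrt_smul_sum hind hlaw (Q := fun t => ‖t‖ ^ 2)
    (fun t => (integral_inner_stdGaussian_sq t).2.1)
    (fun t => (integral_inner_stdGaussian_sq t).1)
    (fun t => (integral_inner_stdGaussian_sq t).2.2) fun t => ?_
  rw [charFun_stdGaussian]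
  simp

/-- With `A` the symmetric part of `t`, the variance `2 tr(A²)` of the projection on `t` is exactly
the quadratic form of `1 + commutationMatrix p` at `t`. -/
theorem tendstoInDistribution_inv_sqrt_smul_sum_vecMulVec
    {U : ∀ n, Fin n → Ω n → EuclideanSpace ℝ (Fin p)} (hind : ∀ n, iIndepFun (U n) (P n))
    (hlaw : ∀ n i, HasLaw (U n i) (stdGaussian (EuclideanSpace ℝ (Fin p))) (P n)) :
    TendstoInDistribution (fun (n : ℕ) ω => (√(n : ℝ))⁻¹ •
      ∑ i, vecE (Matrix.vecMulVec (U n i ω).ofLp (U n i ω).ofLp - 1)) atTop id P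
      (multivariateGaussian 0 (1 + commutationMatrix p)) := by
  have hg : Continuous fun x : EuclideanSpace ℝ (Fin p) =>
      vecE (Matrix.vecMulVec x.ofLp x.ofLp - 1) := by
    refine continuous_vecE.comp ?_
    fun_prop
  have hpr : IsProbabilityMeasure ((stdGaussian (EuclideanSpace ℝ (Fin p))).map
      fun x => vecE (Matrix.vecMulVec x.ofLp x.ofLp - 1)) :=
    Measure.isProbabilityMeasure_map hg.measurable.aemeasurable
  have hH : ∀ t : EuclideanSpace ℝ (Fin p × Fin p),
      (Matrix.of fun i j => (t (i, j) + t (j, i)) / 2).IsHermitian := fun t => by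
    ext i j
    simp [add_comm]
  refine tendstoInDistribution_inv_sqrt_smul_sum (fun n => (hind n).comp
      (fun _ x => vecE (Matrix.vecMulVec x.ofLp x.ofLp - 1)) fun _ => hg.measurable)
    (μ := (stdGaussian (EuclideanSpace ℝ (Fin p))).map
      fun x => vecE (Matrix.vecMulVec x.ofLp x.ofLp - 1))
    (Q := fun t => t.ofLp ⬝ᵥ (1 + commutationMatrix p) *ᵥ t.ofLp)
    (fun n i => ?_) (fun t => ?_) (fun t => ?_) (fun t => ?_) fun t => ?_
  · exact HasLaw.fun_comp (Y := fun x => vecE (Matrix.vecMulVec x.ofLp x.ofLp - 1))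
      ⟨hg.measurable.aemeasurable, rfl⟩ (hlaw n i)
  · rw [integral_map hg.measurable.aemeasurable (by fun_prop)]
    simp_rw [inner_vecE_vecMulVec_sub_one]
    exact (stdGaussian_quadratic (hH t)).2.1
  · rw [integrable_map_measure (by fun_prop) hg.measurable.aemeasurable]
    simp only [Function.comp_def, inner_vecE_vecMulVec_sub_one]
    exact (stdGaussian_quadratic (hH t)).1.integrable_sq
  · rw [integral_map hg.measurable.aemeasurable (by fun_prop)]
    simp_rw [inner_vecE_vecMulVec_sub_one]
    rw [(stdGaussian_quadratic (hH t)).2.2, dotProduct_one_add_commutationMatrix,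
      Fintype.sum_prod_type]
    simp only [Matrix.trace, Matrix.diag, Matrix.mul_apply, Matrix.of_apply, Prod.swap,
      Finset.mul_sum]
    exact Finset.sum_congr rfl fun i _ => Finset.sum_congr rfl fun j _ => by ring
  · rw [charFun_multivariateGaussian (posSemidef_one_add_commutationMatrix p)]
    simp [neg_div]

/-- Central limit theorem for the sample covariance matrix of standard Gaussian vectors. -/
theorem tendstoInDistribution_sampleCov
    {U : ∀ n, Fin n → Ω n → EuclideanSpace ℝ (Fin p)} (hind : ∀ n, iIndepFun (U n) (P n))
    (hlaw : ∀ n i, HasLaw (U n i) (stdGaussian (EuclideanSpace ℝ (Fin p))) (P n)) :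
    TendstoInDistribution
      (fun (n : ℕ) ω => vecE (√(n : ℝ) • (sampleCov (fun i => U n i ω) - 1))) atTop id P
      (multivariateGaussian 0 (1 + commutationMatrix p)) := by
  have hUm := fun n i => (hlaw n i).aemeasurable
  have hUm' : ∀ n i a, AEMeasurable (fun ω => U n i ω a) (P n) := fun n i a => by
    have : Measurable fun x : EuclideanSpace ℝ (Fin p) => x a := by fun_prop
    exact this.comp_aemeasurable (hUm n i)
  refine (tendstoInDistribution_inv_sqrt_smul_sum_vecMulVec hind hlaw).of_isLittleOP_sub
    (fun n => ?_) ?_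
  · rw [aemeasurable_vecE]
    intro a b
    simp only [Matrix.smul_apply, Matrix.sub_apply, sampleCov_apply, sampleMean_apply, smul_eq_mul]
    fun_prop
  refine isLittleOP_of_uniformFilter (good := fun _ _ => True)
    (tendstoInDistribution_inv_sqrt_smul_sum_stdGaussian hind hlaw).isBigOP
    (Eventually.of_forall fun n => ae_of_all _ fun _ => trivial) fun K => ?_
  set l := uniformFilter fun n (ω : Ω n) => True ∧ ‖(√(n : ℝ))⁻¹ • ∑ i, U n i ω‖ ≤ K
  have hfst : Tendsto (fun p : Σ n, Ω n => (√(p.1 : ℝ))⁻¹) l (𝓝 0) :=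
    (tendsto_inv_atTop_zero.comp (Real.tendsto_sqrt_atTop.comp tendsto_natCast_atTop_atTop)).comp
      (tendsto_fst_uniformFilter _)
  -- Centering at the sample mean costs exactly this term: `n^(-1/2)` times the outer square of the
  -- tight vector `n^(-1/2) ∑ U_i`.
  have key : Tendsto (fun q : Σ n, Ω n => vecE (-((√(q.1 : ℝ))⁻¹ •
      Matrix.vecMulVec ((√(q.1 : ℝ))⁻¹ • ∑ i, U q.1 i q.2).ofLp
        ((√(q.1 : ℝ))⁻¹ • ∑ i, U q.1 i q.2).ofLp))) l (𝓝 0) := by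
    refine tendsto_vecE_zero fun a b => ?_
    have hb : ∀ a, ∀ᶠ q : Σ n, Ω n in l, |((√(q.1 : ℝ))⁻¹ • ∑ i, U q.1 i q.2) a| ≤ K := fun a =>
      eventually_uniformFilter.2 (Eventually.of_forall fun n ω h =>
        (PiLp.norm_apply_le _ a).trans h.2)
    rw [← neg_zero]
    refine Tendsto.neg ?_
    refine hfst.zero_mul_isBoundedUnder_le (isBoundedUnder_of_eventually_le (a := K * K) ?_)
    filter_upwards [hb a, hb b] with q h1 h2
    rw [Function.comp_apply, Real.norm_eq_abs, Matrix.vecMulVec_apply, abs_mul]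
    exact mul_le_mul h1 h2 (abs_nonneg _) ((abs_nonneg _).trans h1)
  refine key.congr' (eventually_uniformFilter.2 ?_)
  filter_upwards [eventually_ne_atTop 0] with n hn ω _
  have hn' : (0 : ℝ) < n := Nat.cast_pos.2 (Nat.pos_of_ne_zero hn)
  have hs : √(n : ℝ) ≠ 0 := (Real.sqrt_pos.2 hn').ne'
  have hss : √(n : ℝ) ^ 2 = n := Real.sq_sqrt hn'.le
  ext ⟨b, a⟩
  simp only [vecE_apply, Matrix.neg_apply, Matrix.smul_apply, Matrix.vecMulVec_apply,
    Matrix.sub_apply, sampleCov_apply_eq hn, sampleMean_apply, smul_eq_mul, PiLp.sub_apply,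
    PiLp.smul_apply, WithLp.ofLp_sum, Finset.sum_apply, WithLp.ofLp_smul, Pi.smul_apply,
    Finset.sum_sub_distrib, Finset.sum_const, Finset.card_univ, Fintype.card_fin, nsmul_eq_mul]
  generalize √(n : ℝ) = s at hs hss
  rw [← hss]
  field_simp
  ring

end SampleCovariance

/-! ### Uniqueness and closedness of ordered eigenvector matrices; Krylov criterion -/

section Eigenvectors

variable {q : ℕ}

/-- No nonzero eigenvector of `a` has a vanishing first coordinate. -/
def FirstNonvanishing (a : Matrix (Fin (q + 1)) (Fin (q + 1)) ℝ) : Prop :=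
  ∀ (c : ℝ) (x : Fin (q + 1) → ℝ), a *ᵥ x = c • x → x 0 = 0 → x = 0

theorem orthogonal_col_dotProduct {p : ℕ} {U : Matrix (Fin p) (Fin p) ℝ}
    (hU : U ∈ Matrix.orthogonalGroup (Fin p) ℝ) (j k : Fin p) :
    U.col j ⬝ᵥ U.col k = if j = k then 1 else 0 := by
  have h1 := congrFun (congrFun ((Matrix.mem_orthogonalGroup_iff' _ _).1 hU) j) k
  rw [Matrix.one_apply] at h1
  rw [← h1]
  rfl

theorem orthogonal_col_ne_zero {p : ℕ} {U : Matrix (Fin p) (Fin p) ℝ}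
    (hU : U ∈ Matrix.orthogonalGroup (Fin p) ℝ) (j : Fin p) : U.col j ≠ 0 := by
  intro h
  have := orthogonal_col_dotProduct hU j j
  simp [h] at this

theorem transpose_mul_eq_of_eigen {p : ℕ} {a U : Matrix (Fin p) (Fin p) ℝ}
    (hU : U ∈ Matrix.orthogonalGroup (Fin p) ℝ) {ev : Fin p → ℝ}
    (hev : ∀ j, a *ᵥ U.col j = ev j • U.col j) : Uᵀ * a = Matrix.diagonal ev * Uᵀ := by
  have h1 : a * U = U * Matrix.diagonal ev := by
    ext i j
    have := congrFun (hev j) i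
    rw [Matrix.mul_diagonal]
    simpa [Matrix.mulVec, dotProduct, Matrix.mul_apply, mul_comm] using this
  calc Uᵀ * a = Uᵀ * (a * U) * Uᵀ := by
        rw [Matrix.mul_assoc, Matrix.mul_assoc, (Matrix.mem_orthogonalGroup_iff _ _).1 hU,
          Matrix.mul_one]
    _ = _ := by
        rw [h1, ← Matrix.mul_assoc, (Matrix.mem_orthogonalGroup_iff' _ _).1 hU, Matrix.one_mul]

theorem exists_eq_of_eigen {p : ℕ} {a U : Matrix (Fin p) (Fin p) ℝ}
    (hU : U ∈ Matrix.orthogonalGroup (Fin p) ℝ) {ev : Fin p → ℝ}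
    (hev : ∀ j, a *ᵥ U.col j = ev j • U.col j) {c : ℝ} {x : Fin p → ℝ} (hx : a *ᵥ x = c • x)
    (hx0 : x ≠ 0) : ∃ j, ev j = c := by
  by_contra! hne
  have h1 : Uᵀ *ᵥ (a *ᵥ x) = Matrix.diagonal ev *ᵥ (Uᵀ *ᵥ x) := by
    rw [Matrix.mulVec_mulVec, transpose_mul_eq_of_eigen hU hev, Matrix.mulVec_mulVec]
  have h2 : Uᵀ *ᵥ x = 0 := by
    ext j
    have h3 := congrFun h1 j
    rw [hx, Matrix.mulVec_smul, Matrix.mulVec_diagonal, Pi.smul_apply, smul_eq_mul] at h3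
    have h4 : (ev j - c) * (Uᵀ *ᵥ x) j = 0 := by linarith
    exact (mul_eq_zero.1 h4).resolve_left (sub_ne_zero.2 (hne j))
  apply hx0
  calc x = (U * Uᵀ) *ᵥ x := by rw [(Matrix.mem_orthogonalGroup_iff _ _).1 hU, Matrix.one_mulVec]
    _ = 0 := by rw [← Matrix.mulVec_mulVec, h2, Matrix.mulVec_zero]

theorem FirstNonvanishing.apply_ne_zero {a U : Matrix (Fin (q + 1)) (Fin (q + 1)) ℝ}
    (ha : FirstNonvanishing a) (hU : U ∈ Matrix.orthogonalGroup (Fin (q + 1)) ℝ)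
    {ev : Fin (q + 1) → ℝ} (hev : ∀ j, a *ᵥ U.col j = ev j • U.col j) (j : Fin (q + 1)) :
    U 0 j ≠ 0 := fun h => orthogonal_col_ne_zero hU j (ha _ _ (hev j) h)

/-- The combination `y 0 • x - x 0 • y` lies in the same eigenspace and has first coordinate zero,
so it vanishes: eigenspaces are at most one-dimensional. -/
theorem FirstNonvanishing.eq_of_eigen {a : Matrix (Fin (q + 1)) (Fin (q + 1)) ℝ}
    (ha : FirstNonvanishing a) {c : ℝ} {x y : Fin (q + 1) → ℝ} (hx : a *ᵥ x = c • x)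
    (hy : a *ᵥ y = c • y) : y 0 • x = x 0 • y := by
  rw [← sub_eq_zero]
  refine ha c _ ?_ ?_
  · rw [Matrix.mulVec_sub, Matrix.mulVec_smul, Matrix.mulVec_smul, hx, hy, smul_sub, smul_comm,
      smul_comm (x 0)]
  · simp [mul_comm]

theorem FirstNonvanishing.injective {a U : Matrix (Fin (q + 1)) (Fin (q + 1)) ℝ}
    (ha : FirstNonvanishing a) (hU : U ∈ Matrix.orthogonalGroup (Fin (q + 1)) ℝ)
    {ev : Fin (q + 1) → ℝ} (hev : ∀ j, a *ᵥ U.col j = ev j • U.col j) :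
    Function.Injective ev := by
  intro j k hjk
  by_contra hne
  have h1 := ha.eq_of_eigen (hev j) (hjk ▸ hev k)
  have h2 := congrArg (U.col j ⬝ᵥ ·) h1
  simp only [dotProduct_smul, orthogonal_col_dotProduct hU, if_true, hne, if_false,
    smul_eq_mul, mul_one, mul_zero] at h2
  exact ha.apply_ne_zero hU hev k h2

/-- The matrix of ordered eigenvectors with nonnegative first coordinates is unique. -/
theorem FirstNonvanishing.unique {a U W : Matrix (Fin (q + 1)) (Fin (q + 1)) ℝ}
    (ha : FirstNonvanishing a) (hU : IsEigenvectorMatrix a U) (hW : IsEigenvectorMatrix a W)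
    (hU0 : ∀ j, 0 ≤ U 0 j) (hW0 : ∀ j, 0 ≤ W 0 j) : U = W := by
  obtain ⟨hUo, e, he, hUe⟩ := hU
  obtain ⟨hWo, f, hf, hWf⟩ := hW
  -- Both eigenvalue lists are strictly decreasing and enumerate the same spectrum, so they agree.
  have hef : e = f := by
    have he' : StrictMono (-e) :=
      (he.strictAnti_of_injective (ha.injective hUo hUe)).neg
    have hf' : StrictMono (-f) :=
      (hf.strictAnti_of_injective (ha.injective hWo hWf)).neg
    have hr : Set.range e = Set.range f := by
      refine Set.Subset.antisymm ?_ ?_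
      · rintro _ ⟨j, rfl⟩
        exact exists_eq_of_eigen hWo hWf (hUe j) (orthogonal_col_ne_zero hUo j)
      · rintro _ ⟨j, rfl⟩
        exact exists_eq_of_eigen hUo hUe (hWf j) (orthogonal_col_ne_zero hWo j)
    have hr' : Set.range (-e) = Set.range (-f) := by
      have h : ∀ g : Fin (q + 1) → ℝ, Set.range (-g) = -Set.range g := fun g => by
        ext x
        simp [neg_eq_iff_eq_neg]
      rw [h, h, hr]
    exact neg_injective ((StrictMono.range_inj he' hf').1 hr')
  subst hef
  ext i j
  have h1 : W 0 j • U.col j = U 0 j • W.col j := ha.eq_of_eigen (hUe j) (hWf j)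
  -- Comparing norms of the two proportional unit columns fixes the first coordinate up to sign, and
  -- the sign convention fixes the rest.
  have h2 : W 0 j * W 0 j = U 0 j * U 0 j := by
    have h3 : (W 0 j • U.col j) ⬝ᵥ (W 0 j • U.col j) = (U 0 j • W.col j) ⬝ᵥ (U 0 j • W.col j) := by
      rw [h1]
    simpa [smul_dotProduct, dotProduct_smul, orthogonal_col_dotProduct hUo,
      orthogonal_col_dotProduct hWo] using h3
  have h4 : W 0 j = U 0 j := (mul_self_inj (hW0 j) (hU0 j)).1 h2
  have h5 := congrFun h1 i
  simp only [Pi.smul_apply, Matrix.col_apply, smul_eq_mul, h4] at h5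
  exact mul_left_cancel₀ (ha.apply_ne_zero hUo hUe j) h5

theorem isCompact_orthogonalGroup (p : ℕ) :
    IsCompact {U : Matrix (Fin p) (Fin p) ℝ | U ∈ Matrix.orthogonalGroup (Fin p) ℝ} := by
  have h1 : IsCompact (Set.pi Set.univ fun _ : Fin p => Set.pi Set.univ fun _ : Fin p =>
      Set.Icc (-1 : ℝ) 1) := isCompact_univ_pi fun _ => isCompact_univ_pi fun _ => isCompact_Icc
  refine IsCompact.of_isClosed_subset (X := Fin p → Fin p → ℝ) h1 ?_ ?_
  · have : IsClosed {U : Matrix (Fin p) (Fin p) ℝ | U * Uᵀ = 1} :=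
      isClosed_eq (by fun_prop) continuous_const
    simp only [Matrix.mem_orthogonalGroup_iff]
    exact this
  · intro U hU i _ j _
    have := entry_norm_bound_of_unitary hU i j
    rwa [Real.norm_eq_abs, abs_le] at this

/-- Eliminates the existential eigenvalues, which must be the diagonal of `Uᵀ * a * U`; what is left
is a set of closed conditions in `(a, U)`. -/
theorem isEigenvectorMatrix_iff {p : ℕ} {a U : Matrix (Fin p) (Fin p) ℝ} :
    IsEigenvectorMatrix a U ↔ U ∈ Matrix.orthogonalGroup (Fin p) ℝ ∧
      (∀ j k, j ≤ k → (Uᵀ * a * U) k k ≤ (Uᵀ * a * U) j j) ∧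
      ∀ j i, (a * U) i j = (Uᵀ * a * U) j j * U i j := by
  constructor
  · rintro ⟨hU, ev, hev, h⟩
    have h1 : Uᵀ * a * U = Matrix.diagonal ev := by
      rw [transpose_mul_eq_of_eigen hU h, Matrix.mul_assoc,
        (Matrix.mem_orthogonalGroup_iff' _ _).1 hU, Matrix.mul_one]
    refine ⟨hU, fun j k hjk => by simpa [h1] using hev hjk, fun j i => ?_⟩
    rw [h1, Matrix.diagonal_apply_eq]
    exact congrFun (h j) i
  · rintro ⟨hU, h1, h2⟩
    exact ⟨hU, fun j => (Uᵀ * a * U) j j, fun j k hjk => h1 j k hjk, fun j => funext fun i => h2 j i⟩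

/-- The set of matrices having an admissible eigenvector matrix in a given closed set is closed. -/
theorem isClosed_setOf_exists_isEigenvectorMatrix
    {C : Set (Matrix (Fin (q + 1)) (Fin (q + 1)) ℝ)} (hC : IsClosed C) :
    IsClosed {a : Matrix (Fin (q + 1)) (Fin (q + 1)) ℝ |
      ∃ E ∈ C, IsEigenvectorMatrix a Eᵀ ∧ ∀ j, 0 ≤ E j 0} := by
  set K := {U : Matrix (Fin (q + 1)) (Fin (q + 1)) ℝ |
    U ∈ Matrix.orthogonalGroup (Fin (q + 1)) ℝ}
  have : CompactSpace K := isCompact_iff_compactSpace.1 (isCompact_orthogonalGroup _)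
  have hc : IsClosed {x : Matrix (Fin (q + 1)) (Fin (q + 1)) ℝ × K |
      x.2.1ᵀ ∈ C ∧
      ((∀ j k, j ≤ k → (x.2.1ᵀ * x.1 * x.2.1) k k ≤
        (x.2.1ᵀ * x.1 * x.2.1) j j) ∧
      ∀ j i, (x.1 * x.2.1) i j =
        (x.2.1ᵀ * x.1 * x.2.1) j j * x.2.1 i j) ∧
      ∀ j, 0 ≤ x.2.1 0 j} := by
    have hm : Continuous fun x : Matrix (Fin (q + 1)) (Fin (q + 1)) ℝ × K =>
        x.2.1ᵀ * x.1 * x.2.1 := by fun_prop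
    have hm' : Continuous fun x : Matrix (Fin (q + 1)) (Fin (q + 1)) ℝ × K =>
        x.1 * x.2.1 := by fun_prop
    have hm'' : Continuous fun x : Matrix (Fin (q + 1)) (Fin (q + 1)) ℝ × K =>
        x.2.1 := by fun_prop
    refine (hC.preimage hm''.matrix_transpose).and ((IsClosed.and ?_ ?_).and ?_)
    · simp only [Set.ofPred_forall]
      exact isClosed_iInter fun j => isClosed_iInter fun k => isClosed_iInter fun _ =>
        isClosed_le (hm.matrix_elem k k) (hm.matrix_elem j j)
    · simp only [Set.ofPred_forall]
      exact isClosed_iInter fun j => isClosed_iInter fun i =>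
        isClosed_eq (hm'.matrix_elem i j) ((hm.matrix_elem j j).mul (hm''.matrix_elem i j))
    · simp only [Set.ofPred_forall]
      exact isClosed_iInter fun j => isClosed_le continuous_const (hm''.matrix_elem 0 j)
  -- The set is the projection of a closed set along the compact orthogonal group.
  convert isClosedMap_fst_of_compactSpace _ hc using 1
  ext a
  simp only [Set.mem_ofPred_eq, Set.mem_image, Prod.exists, exists_and_right, exists_eq_right,
    isEigenvectorMatrix_iff]
  constructor
  · rintro ⟨E, hE, ⟨h1, h2⟩, h3⟩
    exact ⟨⟨Eᵀ, h1⟩, by simpa using hE, h2, h3⟩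
  · rintro ⟨⟨U, hU⟩, h1, h2, h3⟩
    exact ⟨Uᵀ, h1, ⟨by rw [Matrix.transpose_transpose]; exact hU, by simpa using h2⟩, h3⟩

/-- The Krylov matrix of `a` with respect to the first row. -/
def krylov {R : Type*} [CommRing R] (a : Matrix (Fin (q + 1)) (Fin (q + 1)) R) :
    Matrix (Fin (q + 1)) (Fin (q + 1)) R :=
  Matrix.of fun k j => (a ^ (k : ℕ)) 0 j

/-- If `a x = c x` and `x 0 = 0`, every `(a ^ k x) 0 = c ^ k * x 0` is zero, so `x` is in the kernel
of the Krylov matrix. -/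
theorem firstNonvanishing_of_det_krylov_ne_zero {a : Matrix (Fin (q + 1)) (Fin (q + 1)) ℝ}
    (h : (krylov a).det ≠ 0) : FirstNonvanishing a := by
  intro c x hx hx0
  have hpow : ∀ k : ℕ, (a ^ k) *ᵥ x = c ^ k • x := by
    intro k
    induction k with
    | zero => simp
    | succ k ih => rw [pow_succ, ← Matrix.mulVec_mulVec, hx, Matrix.mulVec_smul, ih, smul_smul,
        pow_succ, mul_comm]
  refine Matrix.eq_zero_of_mulVec_eq_zero h (funext fun k => ?_)
  have := congrFun (hpow k) 0
  rw [Pi.smul_apply, hx0, smul_zero] at this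
  exact this

theorem det_krylov_smul (c : ℝ) (a : Matrix (Fin (q + 1)) (Fin (q + 1)) ℝ) :
    (krylov (c • a)).det = (∏ k : Fin (q + 1), c ^ (k : ℕ)) * (krylov a).det := by
  rw [← Matrix.det_mul_column]
  congr 1
  ext k j
  simp [krylov, smul_pow]

/-- The adjacency matrix of a path. -/
def pathMatrix (q : ℕ) : Matrix (Fin (q + 1)) (Fin (q + 1)) ℝ :=
  Matrix.of fun i j => if (i : ℕ) = j + 1 ∨ (j : ℕ) = i + 1 then 1 else 0

theorem pathMatrix_transpose (q : ℕ) : (pathMatrix q)ᵀ = pathMatrix q := by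
  ext i j
  simp [pathMatrix, or_comm]

/-- Entries of the power count walks from vertex `0`: `k` steps cannot pass vertex `k`, and reach it
in one way. The Krylov matrix is thus lower triangular with unit diagonal. -/
theorem pathMatrix_pow (q k : ℕ) :
    (∀ j : Fin (q + 1), k < (j : ℕ) → (pathMatrix q ^ k) 0 j = 0) ∧
      ∀ j : Fin (q + 1), k = (j : ℕ) → (pathMatrix q ^ k) 0 j = 1 := by
  induction k with
  | zero =>
    refine ⟨fun j hj => ?_, fun j hj => ?_⟩
    · rw [pow_zero, Matrix.one_apply_ne]
      rintro rfl
      simp at hj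
    · obtain rfl : j = 0 := Fin.ext hj.symm
      simp
  | succ k ih =>
    refine ⟨fun j hj => ?_, fun j hj => ?_⟩
    · rw [pow_succ, Matrix.mul_apply]
      refine Finset.sum_eq_zero fun l _ => ?_
      rcases lt_or_ge k (l : ℕ) with hl | hl
      · rw [ih.1 l hl, zero_mul]
      · rw [pathMatrix, Matrix.of_apply, if_neg (by omega), mul_zero]
    · have hk : k < q + 1 := by omega
      rw [pow_succ, Matrix.mul_apply, Finset.sum_eq_single ⟨k, hk⟩]
      · rw [ih.2 _ rfl, pathMatrix, Matrix.of_apply, if_pos (Or.inr hj.symm), one_mul]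
      · intro l _ hl
        rcases lt_trichotomy k (l : ℕ) with h | h | h
        · rw [ih.1 l h, zero_mul]
        · exact absurd (Fin.ext h.symm) hl
        · rw [pathMatrix, Matrix.of_apply, if_neg (by omega), mul_zero]
      · simp

theorem det_krylov_pathMatrix (q : ℕ) : (krylov (pathMatrix q)).det = 1 := by
  rw [Matrix.det_of_isLowerTriangular]
  · exact Finset.prod_eq_one fun j _ => (pathMatrix_pow q j).2 j rfl
  · intro k j hkj
    exact (pathMatrix_pow q k).1 j hkj

/-- For `t ≠ 0` factor `a + t b = t (b + t⁻¹ a)`. The determinant for `b + s a` is a polynomial in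
`s`, nonzero because its value at `s = 0` belongs to `b`. -/
theorem finite_setOf_det_krylov_eq_zero (a b : Matrix (Fin (q + 1)) (Fin (q + 1)) ℝ)
    (hb : (krylov b).det ≠ 0) : {t : ℝ | (krylov (a + t • b)).det = 0}.Finite := by
  set M : Matrix (Fin (q + 1)) (Fin (q + 1)) (Polynomial ℝ) :=
    b.map Polynomial.C + (Polynomial.X : Polynomial ℝ) • a.map Polynomial.C
  have heval : ∀ s : ℝ, (krylov M).det.eval s = (krylov (b + s • a)).det := by
    intro s
    have h1 : M.map (Polynomial.evalRingHom s) = b + s • a := by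
      ext i j
      simp [M, mul_comm (a i j)]
    rw [← Polynomial.coe_evalRingHom, RingHom.map_det, RingHom.mapMatrix_apply]
    congr 1
    ext k j
    have h2 : (M ^ (k : ℕ)).map (Polynomial.evalRingHom s) = (b + s • a) ^ (k : ℕ) := by
      rw [← h1, ← RingHom.mapMatrix_apply, ← RingHom.mapMatrix_apply, map_pow]
    exact congrFun (congrFun h2 0) j
  have hne : (krylov M).det ≠ 0 := by
    intro h
    have := heval 0
    rw [h, Polynomial.eval_zero, zero_smul, add_zero] at this
    exact hb this.symm
  have hfin : {s : ℝ | (krylov M).det.eval s = 0}.Finite :=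
    (Polynomial.finite_setOfPred_isRoot hne)
  refine ((hfin.image fun s => s⁻¹).union (Set.finite_singleton (0 : ℝ))).subset fun t ht => ?_
  rcases eq_or_ne t 0 with rfl | ht0
  · exact Or.inr rfl
  refine Or.inl ⟨t⁻¹, ?_, inv_inv t⟩
  have h1 : a + t • b = t • (b + t⁻¹ • a) := by
    rw [smul_add, smul_smul, mul_inv_cancel₀ ht0, one_smul, add_comm (t • b)]
  rw [Set.mem_ofPred_eq, h1, det_krylov_smul] at ht
  rw [Set.mem_ofPred_eq, heval]
  exact (mul_eq_zero.1 ht).resolve_left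
    (Finset.prod_ne_zero_iff.2 fun k _ => pow_ne_zero _ ht0)

end Eigenvectors

/-! ### Almost sure uniqueness in the Gaussian limit -/

section Nondegenerate

open scoped RealInnerProductSpace

variable {q : ℕ}

/-- The matrix whose columns are stacked in `x`. -/
def unvecE {m n : Type*} (x : EuclideanSpace ℝ (n × m)) : Matrix m n ℝ :=
  Matrix.of fun i j => x (j, i)

theorem unvecE_vecE {m n : Type*} (A : Matrix m n ℝ) : unvecE (vecE A) = A := rfl

theorem continuous_unvecE {m n : Type*} : Continuous (unvecE : EuclideanSpace ℝ (n × m) → _) :=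
  continuous_matrix fun i j => by simp only [unvecE, Matrix.of_apply]; fun_prop

/-- Cauchy–Schwarz against the symmetrized `t`; it allows an independent Gaussian multiple of a
symmetric direction to be split off. -/
theorem posSemidef_one_add_commutationMatrix_sub {p : ℕ} {u : Fin p × Fin p → ℝ}
    (hu : ∀ a, u a.swap = u a) (hu1 : ∑ a, u a ^ 2 ≤ 1) :
    (1 + commutationMatrix p - Matrix.vecMulVec u u).PosSemidef := by
  refine Matrix.PosSemidef.of_dotProduct_mulVec_nonneg ?_ fun t => ?_
  · refine (posSemidef_one_add_commutationMatrix p).1.sub ?_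
    ext a b
    simp [Matrix.vecMulVec_apply, mul_comm]
  · rw [star_trivial, Matrix.sub_mulVec, dotProduct_sub, dotProduct_one_add_commutationMatrix,
      Matrix.vecMulVec_mulVec]
    have h1 : u ⬝ᵥ t = 2⁻¹ * ∑ a, u a * (t a + t a.swap) := by
      have h : ∑ a : Fin p × Fin p, u a * t a.swap = ∑ a, u a * t a :=
        Fintype.sum_equiv (Equiv.prodComm _ _) _ _ fun a => by simp [hu]
      simp_rw [mul_add, Finset.sum_add_distrib, h, dotProduct]
      ring
    have h2 := Finset.sum_mul_sq_le_sq_mul_sq Finset.univ u fun a => t a + t a.swap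
    have h3 : 0 ≤ ∑ a, (t a + t a.swap) ^ 2 := by positivity
    have h4 : t ⬝ᵥ (MulOpposite.op (u ⬝ᵥ t) • u) = (u ⬝ᵥ t) ^ 2 := by
      rw [op_smul_eq_smul, dotProduct_smul, smul_eq_mul, dotProduct_comm t u, pow_two]
    rw [h4, h1]
    nlinarith [mul_le_mul_of_nonneg_right hu1 h3]

theorem charFun_map_smul_gaussianReal {E : Type*} [NormedAddCommGroup E]
    [InnerProductSpace ℝ E] [MeasurableSpace E] [BorelSpace E] (u t : E) :
    charFun ((gaussianReal 0 1).map fun g => g • u) t = Complex.exp (-(⟪u, t⟫ ^ 2 : ℝ) / 2) := by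
  have hc : Continuous fun g : ℝ => g • u := by fun_prop
  have h := charFun_gaussianReal (μ := 0) (v := 1) ⟪u, t⟫
  rw [charFun_apply_real] at h
  rw [charFun_apply, integral_map hc.measurable.aemeasurable (by fun_prop)]
  simp_rw [real_inner_smul_left]
  convert h using 1
  · congr 1
    ext g
    push_cast
    ring_nf
  · simp [neg_div]

/-- Splitting off a one-dimensional Gaussian component. -/
theorem multivariateGaussian_eq_map_prod {ι : Type*} [Fintype ι] [DecidableEq ι]
    {S : Matrix ι ι ℝ} {u : EuclideanSpace ℝ ι} (hS : S.PosSemidef)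
    (hSu : (S - Matrix.vecMulVec u.ofLp u.ofLp).PosSemidef) :
    multivariateGaussian 0 S =
      ((multivariateGaussian 0 (S - Matrix.vecMulVec u.ofLp u.ofLp)).prod
        ((gaussianReal 0 1).map fun g => g • u)).map fun x => x.1 + x.2 := by
  have hc : Continuous fun g : ℝ => g • u := by fun_prop
  have h1 := Measure.isProbabilityMeasure_map (μ := gaussianReal 0 1) hc.measurable.aemeasurable
  have h2 := Measure.isProbabilityMeasure_map
    (μ := (multivariateGaussian 0 (S - Matrix.vecMulVec u.ofLp u.ofLp)).prod
      ((gaussianReal 0 1).map fun g => g • u)) (f := fun x => x.1 + x.2) (by fun_prop)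
  refine Measure.ext_of_charFun ?_
  rw [charFun_map_add_prod_eq_mul]
  ext t
  rw [Pi.mul_apply, charFun_multivariateGaussian hS, charFun_multivariateGaussian hSu,
    charFun_map_smul_gaussianReal, ← Complex.exp_add, Matrix.sub_mulVec, dotProduct_sub,
    Matrix.vecMulVec_mulVec, op_smul_eq_smul, dotProduct_smul, smul_eq_mul,
    dotProduct_comm t.ofLp u.ofLp]
  have h3 : ⟪u, t⟫ = u.ofLp ⬝ᵥ t.ofLp := by
    simp [PiLp.inner_apply, dotProduct, mul_comm]
  rw [h3]
  congr 1
  push_cast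
  ring

theorem ae_det_krylov_ne_zero (D : Matrix (Fin (q + 1)) (Fin (q + 1)) ℝ) :
    ∀ᵐ x ∂(multivariateGaussian 0 (1 + commutationMatrix (q + 1))),
      (krylov (unvecE x + D)).det ≠ 0 := by
  -- Scales the path direction into the unit ball. The added `1` keeps `c` positive even for `q =
  -- 0`, where the path matrix is zero.
  set c : ℝ := (1 + ‖vecE (pathMatrix q)‖)⁻¹
  have hc : 0 < c := by positivity
  set u : EuclideanSpace ℝ (Fin (q + 1) × Fin (q + 1)) := c • vecE (pathMatrix q)
  have hu : ∀ a, u a.swap = u a := fun a => by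
    simp only [u, PiLp.smul_apply, vecE_apply]
    congr 1
    exact congrFun (congrFun (pathMatrix_transpose q) _) _
  have hu1 : ∑ a, u a ^ 2 ≤ 1 := by
    rw [← EuclideanSpace.real_norm_sq_eq, norm_smul, Real.norm_of_nonneg hc.le]
    refine pow_le_one₀ (by positivity) ?_
    rw [inv_mul_le_iff₀ (by positivity)]
    linarith
  have hcg : Continuous fun g : ℝ => g • u := by fun_prop
  have hcl : IsClosed {x : EuclideanSpace ℝ (Fin (q + 1) × Fin (q + 1)) |
      (krylov (unvecE x + D)).det = 0} := by
    refine isClosed_eq (Continuous.matrix_det ?_) continuous_const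
    refine continuous_matrix fun k j => ?_
    exact ((continuous_unvecE.add continuous_const).pow _).matrix_elem 0 j
  have := Measure.isProbabilityMeasure_map (μ := gaussianReal 0 1) hcg.measurable.aemeasurable
  have := nullSingletonClass_gaussianReal (μ := 0) (v := 1) one_ne_zero
  rw [multivariateGaussian_eq_map_prod (u := u) (posSemidef_one_add_commutationMatrix _)
    (posSemidef_one_add_commutationMatrix_sub hu hu1), ae_iff]
  simp only [ne_eq, not_not]
  have hm : Measurable fun x : EuclideanSpace ℝ (Fin (q + 1) × Fin (q + 1)) ×
    EuclideanSpace ℝ (Fin (q + 1) × Fin (q + 1)) => x.1 + x.2 := by fun_prop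
  rw [Measure.map_apply hm hcl.measurableSet, Measure.measure_prod_null (hm hcl.measurableSet)]
  refine ae_of_all _ fun x => ?_
  rw [Pi.zero_apply]
  beta_reduce
  rw [Measure.map_apply hcg.measurable]
  · refine Set.Finite.measure_zero ?_ _
    have hfin := finite_setOf_det_krylov_eq_zero (unvecE x + D) (pathMatrix q)
      (by rw [det_krylov_pathMatrix]; exact one_ne_zero)
    refine (hfin.preimage (f := fun g : ℝ => g * c)
      (mul_left_injective₀ hc.ne').injOn).subset fun g hg => ?_
    have h1 : unvecE (x + g • u) + D = unvecE x + D + (g * c) • pathMatrix q := by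
      ext i j
      simp [unvecE, u, vecE_apply]
      ring
    have h2 : (krylov (unvecE (x + g • u) + D)).det = 0 := hg
    rw [h1] at h2
    exact h2
  · exact measurable_prodMk_left (hm hcl.measurableSet)

theorem ae_firstNonvanishing {Ω' : Type*} [MeasurableSpace Ω'] {P' : Measure Ω'}
    {Z : Ω' → Matrix (Fin (q + 1)) (Fin (q + 1)) ℝ}
    (hZ : HasLaw (fun ω => vecE (Z ω)) (multivariateGaussian 0 (1 + commutationMatrix (q + 1))) P')
    (D : Matrix (Fin (q + 1)) (Fin (q + 1)) ℝ) : ∀ᵐ ω ∂P', FirstNonvanishing (Z ω + D) := by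
  have h := ae_det_krylov_ne_zero D
  rw [← hZ.map_eq] at h
  filter_upwards [ae_of_ae_map hZ.aemeasurable h] with ω hω
  rw [unvecE_vecE] at hω
  exact firstNonvanishing_of_det_krylov_ne_zero hω

/-- Convergence in distribution of symmetric matrices implies that of the matrices of ordered
eigenvectors, provided that the latter are unique in the limit. -/
theorem tendstoInDistribution_eigenvectors
    {Ω : ℕ → Type*} [∀ n, MeasurableSpace (Ω n)] {P : ∀ n, Measure (Ω n)}
    [∀ n, IsProbabilityMeasure (P n)]
    {Ω' : Type*} [MeasurableSpace Ω'] {P' : Measure Ω'} [IsProbabilityMeasure P']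
    {A E : ∀ n, Ω n → Matrix (Fin (q + 1)) (Fin (q + 1)) ℝ}
    {B F : Ω' → Matrix (Fin (q + 1)) (Fin (q + 1)) ℝ}
    (hAB : TendstoInDistribution (fun n ω => vecE (A n ω)) atTop (fun ω => vecE (B ω)) P P')
    (hB : ∀ᵐ ω ∂P', FirstNonvanishing (B ω))
    (hE : ∀ n, AEMeasurable (fun ω => vecE (E n ω)) (P n))
    (hF : AEMeasurable (fun ω => vecE (F ω)) P')
    (hAE : ∀ᶠ n in atTop, ∀ᵐ ω ∂(P n),
      IsEigenvectorMatrix (A n ω) (E n ω)ᵀ ∧ ∀ j, 0 ≤ E n ω j 0)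
    (hBF : ∀ᵐ ω ∂P', IsEigenvectorMatrix (B ω) (F ω)ᵀ ∧ ∀ j, 0 ≤ F ω j 0) :
    TendstoInDistribution (fun n ω => vecE (E n ω)) atTop (fun ω => vecE (F ω)) P P' := by
  -- The closed set attached to `C` consists of the matrices with some admissible eigenvector matrix
  -- in `C`; in the limit uniqueness identifies that matrix with `F`.
  refine hAB.of_closed_relation hE hF fun C hC => ⟨_,
    (isClosed_setOf_exists_isEigenvectorMatrix (hC.preimage continuous_vecE)).preimage
      continuous_unvecE, ?_, ?_⟩
  · filter_upwards [hB, hBF] with ω h1 h2 h3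
    obtain ⟨E', hE', h4, h5⟩ := h3
    rw [unvecE_vecE] at h4
    have := h1.unique h4 h2.1 h5 h2.2
    rw [Matrix.transpose_inj] at this
    rw [← this]
    exact hE'
  · filter_upwards [hAE] with n hn
    filter_upwards [hn] with ω hω hC'
    exact ⟨E n ω, hC', hω.1, hω.2⟩

end Nondegenerate

/-! ### Leading eigenvector under a diverging rank-one spike -/

section Perturbation

variable {q : ℕ}

/-- A diagonal entry is an average of the eigenvalues with weights `U i j ^ 2`, hence at most the
largest one. -/
theorem apply_self_le_of_isEigenvectorMatrix {a U : Matrix (Fin (q + 1)) (Fin (q + 1)) ℝ}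
    (h : IsEigenvectorMatrix a U) (i : Fin (q + 1)) : a i i ≤ (Uᵀ * a * U) 0 0 := by
  obtain ⟨hU, ev, hev, h1⟩ := h
  have h2 := transpose_mul_eq_of_eigen hU h1
  have h3 : a = U * Matrix.diagonal ev * Uᵀ := by
    rw [Matrix.mul_assoc, ← h2, ← Matrix.mul_assoc, (Matrix.mem_orthogonalGroup_iff _ _).1 hU,
      Matrix.one_mul]
  have h4 : (Uᵀ * a * U) 0 0 = ev 0 := by
    rw [h2, Matrix.mul_assoc, (Matrix.mem_orthogonalGroup_iff' _ _).1 hU, Matrix.mul_one,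
      Matrix.diagonal_apply_eq]
  have h5 : a i i = ∑ j, ev j * U i j ^ 2 := by
    conv_lhs => rw [h3]
    rw [Matrix.mul_apply]
    refine Finset.sum_congr rfl fun j _ => ?_
    rw [Matrix.mul_diagonal, Matrix.transpose_apply]
    ring
  have h6 : ∑ j, U i j ^ 2 = 1 := by
    have := congrFun (congrFun ((Matrix.mem_orthogonalGroup_iff _ _).1 hU) i) i
    rw [Matrix.mul_apply, Matrix.one_apply_eq] at this
    simpa [pow_two] using this
  rw [h4, h5]
  calc ∑ j, ev j * U i j ^ 2 ≤ ∑ j, ev 0 * U i j ^ 2 :=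
        Finset.sum_le_sum fun j _ => mul_le_mul_of_nonneg_right (hev (Fin.zero_le j)) (sq_nonneg _)
    _ = ev 0 := by rw [← Finset.mul_sum, h6, mul_one]

/-- First order behaviour of the leading eigenvector of a bounded perturbation of a diverging
rank-one matrix. -/
theorem tendsto_leading_eigenvector {α : Type*} {l : Filter α} {c : α → ℝ}
    (hc : Tendsto c l atTop) {v : ℝ} (hv : 0 < v)
    {T E : α → Matrix (Fin (q + 1)) (Fin (q + 1)) ℝ} {κ : ℝ}
    (hT : ∀ᶠ a in l, ∀ i j, |T a i j| ≤ κ)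
    (hE : ∀ᶠ a in l, IsEigenvectorMatrix (T a + diagFirst q (c a * v)) (E a)ᵀ)
    (hE0 : ∀ᶠ a in l, 0 ≤ E a 0 0) :
    Tendsto (fun a => E a 0 0) l (𝓝 1) ∧
      ∀ i : Fin q, Tendsto (fun a => c a * E a 0 i.succ - T a i.succ 0 / v) l (𝓝 0) := by
  set lam : α → ℝ := fun a => (((E a)ᵀ)ᵀ * (T a + diagFirst q (c a * v)) * (E a)ᵀ) 0 0
  set Tw : α → Fin (q + 1) → ℝ := fun a i => ∑ j, T a i j * E a 0 j
  have hcinv : Tendsto (fun a => (c a)⁻¹) l (𝓝 0) := tendsto_inv_atTop_zero.comp hc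
  have hsq : ∀ᶠ a in l, ∑ j, E a 0 j ^ 2 = 1 := by
    filter_upwards [hE] with a ha
    have := congrFun (congrFun ((Matrix.mem_orthogonalGroup_iff' _ _).1 ha.1) 0) 0
    rw [Matrix.mul_apply, Matrix.one_apply_eq] at this
    simpa [pow_two] using this
  have hle : ∀ᶠ a in l, ∀ j, |E a 0 j| ≤ 1 := by
    filter_upwards [hsq] with a ha j
    rw [← sq_le_one_iff_abs_le_one, ← ha]
    exact Finset.single_le_sum (f := fun j => E a 0 j ^ 2) (fun j _ => sq_nonneg _)
      (Finset.mem_univ j)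
  have heq : ∀ᶠ a in l, ∀ i, Tw a i + (Pi.single 0 (c a * v) : Fin (q + 1) → ℝ) i * E a 0 i =
      lam a * E a 0 i := by
    filter_upwards [hE] with a ha i
    have := (isEigenvectorMatrix_iff.1 ha).2.2 0 i
    rw [Matrix.add_mul, Matrix.add_apply, diagFirst, Matrix.diagonal_mul] at this
    exact this
  have hlam : ∀ᶠ a in l, c a * v - κ ≤ lam a := by
    filter_upwards [hE, hT] with a ha hTa
    have h1 := apply_self_le_of_isEigenvectorMatrix ha 0
    simp only [Matrix.add_apply, diagFirst, Matrix.diagonal_apply_eq, Pi.single_eq_same] at h1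
    have h2 := neg_le_of_abs_le (hTa 0 0)
    simp only [lam, diagFirst]
    linarith
  have hTw : ∀ᶠ a in l, ∀ i, |Tw a i| ≤ (q + 1 : ℕ) * κ := by
    filter_upwards [hle, hT] with a h1 h2 i
    calc |Tw a i| ≤ ∑ j, |T a i j * E a 0 j| := Finset.abs_sum_le_sum_abs _ _
      _ ≤ ∑ _j : Fin (q + 1), κ := by
        refine Finset.sum_le_sum fun j _ => ?_
        rw [abs_mul]
        calc _ ≤ |T a i j| * 1 := mul_le_mul_of_nonneg_left (h1 j) (abs_nonneg _)
          _ ≤ κ := by rw [mul_one]; exact h2 i j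
      _ = _ := by simp
  have hden : Tendsto (fun a => c a * v - κ) l atTop :=
    tendsto_atTop_add_const_right _ _ (hc.atTop_mul_const hv)
  -- In these rows `lam a * E a 0 i` equals the bounded quantity `Tw a i`, while `lam a` diverges.
  have hw : ∀ i : Fin q, Tendsto (fun a => E a 0 i.succ) l (𝓝 0) := by
    intro i
    refine squeeze_zero_norm' (a := fun a => (q + 1 : ℕ) * κ * (c a * v - κ)⁻¹) ?_ ?_
    · filter_upwards [heq, hlam, hTw, hden.eventually_gt_atTop 0] with a h1 h2 h3 h4
      have h5 := h1 i.succ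
      rw [Pi.single_eq_of_ne (Fin.succ_ne_zero i), zero_mul, add_zero] at h5
      have h6 := h3 i.succ
      rw [h5, abs_mul, abs_of_pos (h4.trans_le h2)] at h6
      rw [Real.norm_eq_abs, ← div_eq_mul_inv, le_div_iff₀ h4, mul_comm]
      exact (mul_le_mul_of_nonneg_right h2 (abs_nonneg _)).trans h6
    · simpa using (tendsto_inv_atTop_zero.comp hden).const_mul ((q + 1 : ℕ) * κ)
  have hw0 : Tendsto (fun a => E a 0 0) l (𝓝 1) := by
    have h1 : Tendsto (fun a => √(1 - ∑ i : Fin q, E a 0 i.succ ^ 2)) l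
        (𝓝 √(1 - ∑ i : Fin q, (0 : ℝ) ^ 2)) :=
      (tendsto_const_nhds.sub (tendsto_finsetSum _ fun i _ => (hw i).pow 2)).sqrt
    simp only [ne_eq, OfNat.ofNat_ne_zero, not_false_eq_true, zero_pow, Finset.sum_const_zero,
      sub_zero, Real.sqrt_one] at h1
    refine h1.congr' ?_
    filter_upwards [hsq, hE0] with a h2 h3
    rw [Fin.sum_univ_succ] at h2
    rw [← h2, add_sub_cancel_right, Real.sqrt_sq h3]
  refine ⟨hw0, fun i => ?_⟩
  have hbT : ∀ i j, IsBoundedUnder (· ≤ ·) l ((‖·‖) ∘ fun a => T a i j) := fun i j =>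
    isBoundedUnder_of_eventually_le (a := κ) (hT.mono fun a h => h i j)
  have hbTw : ∀ i, IsBoundedUnder (· ≤ ·) l ((‖·‖) ∘ fun a => Tw a i) := fun i =>
    isBoundedUnder_of_eventually_le (a := (q + 1 : ℕ) * κ) (hTw.mono fun a h => h i)
  -- Row zero of the eigenvalue equation, divided by `c a * E a 0 0`.
  have hlamc : Tendsto (fun a => lam a * (c a)⁻¹) l (𝓝 v) := by
    have h1 : Tendsto (fun a => v + (c a)⁻¹ * Tw a 0 * (E a 0 0)⁻¹) l (𝓝 (v + 0 * 1⁻¹)) :=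
      tendsto_const_nhds.add ((hcinv.zero_mul_isBoundedUnder_le (hbTw 0)).mul
        (hw0.inv₀ one_ne_zero))
    rw [zero_mul, add_zero] at h1
    refine h1.congr' ?_
    filter_upwards [heq, hc.eventually_gt_atTop 0, hw0.eventually_const_lt one_half_lt_one]
      with a h2 h3 h4
    have h5 := h2 0
    rw [Pi.single_eq_same] at h5
    have h6 : E a 0 0 ≠ 0 := (one_half_pos.trans h4).ne'
    have h7 : lam a = (Tw a 0 + c a * v * E a 0 0) / E a 0 0 := by
      rw [h5, mul_div_cancel_right₀ _ h6]
    rw [h7]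
    field_simp
    ring
  have hclam : Tendsto (fun a => c a * (lam a)⁻¹) l (𝓝 v⁻¹) := by
    refine (hlamc.inv₀ hv.ne').congr fun a => ?_
    rw [mul_inv, inv_inv, mul_comm]
  have hdiff : Tendsto (fun a => Tw a i.succ - T a i.succ 0) l (𝓝 0) := by
    have h1 : Tendsto (fun a => (E a 0 0 - 1) * T a i.succ 0 +
        ∑ j : Fin q, E a 0 j.succ * T a i.succ j.succ) l (𝓝 (0 + ∑ _j : Fin q, 0)) := by
      refine Tendsto.add ?_ (tendsto_finsetSum _ fun j _ => ?_)
      · refine Tendsto.zero_mul_isBoundedUnder_le ?_ (hbT _ _)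
        simpa using hw0.sub_const 1
      · exact (hw j).zero_mul_isBoundedUnder_le (hbT _ _)
    rw [Finset.sum_const_zero, add_zero] at h1
    refine h1.congr fun a => ?_
    simp only [Tw, Fin.sum_univ_succ]
    simp_rw [mul_comm (E a 0 _)]
    ring
  have hfin : Tendsto (fun a => (Tw a i.succ - T a i.succ 0) * (c a * (lam a)⁻¹) +
      (c a * (lam a)⁻¹ - v⁻¹) * T a i.succ 0) l (𝓝 (0 * v⁻¹ + 0)) := by
    refine (hdiff.mul hclam).add (Tendsto.zero_mul_isBoundedUnder_le ?_ (hbT _ _))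
    simpa using hclam.sub_const v⁻¹
  rw [zero_mul, add_zero] at hfin
  refine hfin.congr' ?_
  filter_upwards [heq, hlam, hden.eventually_gt_atTop 0] with a h1 h2 h3
  have h4 := h1 i.succ
  rw [Pi.single_eq_of_ne (Fin.succ_ne_zero i), zero_mul, add_zero] at h4
  have h5 : lam a ≠ 0 := (h3.trans_le h2).ne'
  rw [h4]
  field_simp
  ring

end Perturbation

/-! ### Whitening: reduction to a standard Gaussian sample -/

section Reduction

open scoped RealInnerProductSpace

variable {q : ℕ}

/-- The square roots of the eigenvalues of the spiked covariance matrix. -/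
noncomputable def spikeScale (q : ℕ) (s : ℝ) : Fin (q + 1) → ℝ := Fin.cons √(1 + s) fun _ => 1

theorem spikeScale_zero (s : ℝ) : spikeScale q s 0 = √(1 + s) := rfl

theorem spikeScale_succ (s : ℝ) (i : Fin q) : spikeScale q s i.succ = 1 := rfl

theorem spikeScale_pos {s : ℝ} (hs : 0 ≤ s) (i : Fin (q + 1)) : 0 < spikeScale q s i := by
  refine Fin.cases ?_ (fun i => ?_) i
  · exact Real.sqrt_pos.2 (by linarith)
  · exact one_pos

theorem diagonal_spikeScale_mul_self {s : ℝ} (hs : 0 ≤ s) :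
    Matrix.diagonal (spikeScale q s) * Matrix.diagonal (spikeScale q s) = 1 + diagFirst q s := by
  rw [Matrix.diagonal_mul_diagonal, diagFirst, ← Matrix.diagonal_one, Matrix.diagonal_add]
  congr 1
  ext i
  refine Fin.cases ?_ (fun i => ?_) i
  · simp [spikeScale_zero, Real.mul_self_sqrt (show 0 ≤ 1 + s by linarith)]
  · simp [spikeScale_succ]

theorem diagonal_spikeScale_mul_inv {s : ℝ} (hs : 0 ≤ s) :
    Matrix.diagonal (spikeScale q s) * Matrix.diagonal (spikeScale q s)⁻¹ = 1 := by
  rw [Matrix.diagonal_mul_diagonal, ← Matrix.diagonal_one]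
  congr 1
  ext i
  exact mul_inv_cancel₀ (spikeScale_pos hs i).ne'

theorem posSemidef_spikedCov {p : ℕ} {s : ℝ} (hs : 0 ≤ s) (θ : EuclideanSpace ℝ (Fin p)) :
    (spikedCov s θ).PosSemidef := by
  refine Matrix.PosSemidef.one.add (Matrix.PosSemidef.smul ?_ hs)
  simpa using Matrix.posSemidef_vecMulVec_self_star θ.ofLp

variable {Γ : Matrix (Fin (q + 1)) (Fin (q + 1)) ℝ} {θ : EuclideanSpace ℝ (Fin (q + 1))}

theorem transpose_mul_spikedCov_mul (hΓ : Γ ∈ Matrix.orthogonalGroup (Fin (q + 1)) ℝ)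
    (hΓθ : Γ.col 0 = θ.ofLp) (s : ℝ) : Γᵀ * spikedCov s θ * Γ = 1 + diagFirst q s := by
  have h1 : Γᵀ *ᵥ θ.ofLp = Pi.single 0 1 := by
    ext i
    have := orthogonal_col_dotProduct hΓ i 0
    rw [← hΓθ, Pi.single_apply, ← this]
    rfl
  have h2 : θ.ofLp ᵥ* Γ = Pi.single 0 1 := by rw [← Matrix.mulVec_transpose, h1]
  rw [spikedCov, Matrix.mul_add, Matrix.add_mul, Matrix.mul_one,
    (Matrix.mem_orthogonalGroup_iff' _ _).1 hΓ, Matrix.mul_smul, Matrix.smul_mul,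
    Matrix.mul_vecMulVec, Matrix.vecMulVec_mul, h1, h2]
  congr 1
  ext i j
  rw [Matrix.smul_apply, Matrix.vecMulVec_apply, diagFirst, Matrix.diagonal_apply]
  by_cases hij : i = j
  · subst hij
    by_cases hi : i = 0 <;> simp [hi]
  · rw [if_neg hij]
    by_cases hi : i = 0
    · subst hi
      simp [Ne.symm hij]
    · simp [hi]

/-- The matrix of the linear map that whitens a sample with a spiked covariance matrix. -/
noncomputable def whitening (Γ : Matrix (Fin (q + 1)) (Fin (q + 1)) ℝ) (s : ℝ) :
    Matrix (Fin (q + 1)) (Fin (q + 1)) ℝ :=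
  Matrix.diagonal (spikeScale q s)⁻¹ * Γᵀ

theorem whitening_mul_spikedCov (hΓ : Γ ∈ Matrix.orthogonalGroup (Fin (q + 1)) ℝ)
    (hΓθ : Γ.col 0 = θ.ofLp) {s : ℝ} (hs : 0 ≤ s) :
    whitening Γ s * spikedCov s θ * (whitening Γ s)ᵀ = 1 := by
  have h1 := diagonal_spikeScale_mul_inv (q := q) hs
  have h2 := mul_eq_one_comm.1 h1
  calc whitening Γ s * spikedCov s θ * (whitening Γ s)ᵀ
      = Matrix.diagonal (spikeScale q s)⁻¹ * (Γᵀ * spikedCov s θ * Γ) *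
          Matrix.diagonal (spikeScale q s)⁻¹ := by
        rw [whitening, Matrix.transpose_mul, Matrix.transpose_transpose, Matrix.diagonal_transpose]
        simp only [Matrix.mul_assoc]
    _ = (Matrix.diagonal (spikeScale q s)⁻¹ * Matrix.diagonal (spikeScale q s)) *
          (Matrix.diagonal (spikeScale q s) * Matrix.diagonal (spikeScale q s)⁻¹) := by
        rw [transpose_mul_spikedCov_mul hΓ hΓθ, ← diagonal_spikeScale_mul_self hs]
        simp only [Matrix.mul_assoc]
    _ = 1 := by rw [h1, h2, Matrix.one_mul]

theorem hasLaw_whitening (hΓ : Γ ∈ Matrix.orthogonalGroup (Fin (q + 1)) ℝ)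
    (hΓθ : Γ.col 0 = θ.ofLp) {s : ℝ} (hs : 0 ≤ s) {Ω₀ : Type*} [MeasurableSpace Ω₀]
    {μ : Measure Ω₀} {Y : Ω₀ → EuclideanSpace ℝ (Fin (q + 1))}
    (hY : HasLaw Y (multivariateGaussian 0 (spikedCov s θ)) μ) :
    HasLaw (fun ω => (WithLp.toLp 2 (whitening Γ s *ᵥ (Y ω).ofLp) :
      EuclideanSpace ℝ (Fin (q + 1)))) (stdGaussian (EuclideanSpace ℝ (Fin (q + 1)))) μ := by
  rw [← multivariateGaussian_zero_one]
  refine hasLaw_multivariateGaussian_comp (posSemidef_spikedCov hs θ) Matrix.PosSemidef.one hY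
    (L := fun x => WithLp.toLp 2 (whitening Γ s *ᵥ x.ofLp)) (by fun_prop)
    (fun t => WithLp.toLp 2 ((whitening Γ s)ᵀ *ᵥ t.ofLp)) (fun x t => ?_) fun t => ?_
  · have h : t.ofLp ⬝ᵥ (whitening Γ s *ᵥ x.ofLp) = ((whitening Γ s)ᵀ *ᵥ t.ofLp) ⬝ᵥ x.ofLp := by
      rw [Matrix.dotProduct_mulVec, Matrix.mulVec_transpose]
    simpa [PiLp.inner_apply, dotProduct] using h
  · rw [Matrix.one_mulVec, Matrix.mulVec_mulVec, Matrix.mulVec_transpose,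
      ← Matrix.dotProduct_mulVec, Matrix.mulVec_mulVec, ← Matrix.mul_assoc,
      whitening_mul_spikedCov hΓ hΓθ hs, Matrix.one_mulVec]

theorem sampleCov_mulVec {p n : ℕ} (M : Matrix (Fin p) (Fin p) ℝ)
    (x : Fin n → EuclideanSpace ℝ (Fin p)) :
    sampleCov (fun i => (WithLp.toLp 2 (M *ᵥ (x i).ofLp) : EuclideanSpace ℝ (Fin p))) =
      M * sampleCov x * Mᵀ := by
  have hmean : sampleMean (fun i => (WithLp.toLp 2 (M *ᵥ (x i).ofLp) :
      EuclideanSpace ℝ (Fin p))) = WithLp.toLp 2 (M *ᵥ (sampleMean x).ofLp) := by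
    ext a
    simp [sampleMean, Matrix.mulVec_smul, Matrix.mulVec_sum]
  rw [sampleCov, hmean, sampleCov, Matrix.mul_smul, Matrix.smul_mul, Finset.mul_sum,
    Finset.sum_mul]
  congr 1
  refine Finset.sum_congr rfl fun i _ => ?_
  rw [Matrix.mul_vecMulVec, Matrix.vecMulVec_mul, Matrix.vecMul_transpose]
  simp [Matrix.mulVec_sub]

theorem IsEigenvectorMatrix.conj {p : ℕ} {A U G : Matrix (Fin p) (Fin p) ℝ}
    (h : IsEigenvectorMatrix A U) (hG : G ∈ Matrix.orthogonalGroup (Fin p) ℝ) :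
    IsEigenvectorMatrix (Gᵀ * A * G) (Gᵀ * U) := by
  obtain ⟨hU, ev, hev, h1⟩ := h
  refine ⟨mul_mem ?_ hU, ev, hev, fun j => ?_⟩
  · rw [Matrix.mem_orthogonalGroup_iff, Matrix.transpose_transpose]
    exact (Matrix.mem_orthogonalGroup_iff' _ _).1 hG
  · have h2 : (Gᵀ * U).col j = Gᵀ *ᵥ U.col j := rfl
    rw [h2, Matrix.mulVec_mulVec, Matrix.mul_assoc (Gᵀ * A), (Matrix.mem_orthogonalGroup_iff _ _).1 hG,
      Matrix.mul_one, ← Matrix.mulVec_mulVec, h1, Matrix.mulVec_smul]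

theorem IsEigenvectorMatrix.smul_sub_one {p : ℕ} {A U : Matrix (Fin p) (Fin p) ℝ}
    (h : IsEigenvectorMatrix A U) {c : ℝ} (hc : 0 ≤ c) : IsEigenvectorMatrix (c • (A - 1)) U := by
  obtain ⟨hU, ev, hev, h1⟩ := h
  refine ⟨hU, fun j => c * (ev j - 1), fun j k hjk => ?_, fun j => ?_⟩
  · exact mul_le_mul_of_nonneg_left (sub_le_sub_right (hev hjk) 1) hc
  · rw [Matrix.smul_mulVec, Matrix.sub_mulVec, h1, Matrix.one_mulVec, mul_smul, sub_smul, one_smul]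

/-- The eigenvectors of the sample covariance matrix in terms of the normalized sample covariance
matrix of the whitened sample. -/
theorem isEigenvectorMatrix_of_sampleCov (hΓ : Γ ∈ Matrix.orthogonalGroup (Fin (q + 1)) ℝ)
    {s : ℝ} (hs : 0 ≤ s) {n : ℕ} {x : Fin n → EuclideanSpace ℝ (Fin (q + 1))}
    {U : Matrix (Fin (q + 1)) (Fin (q + 1)) ℝ} (h : IsEigenvectorMatrix (sampleCov x) U)
    {c : ℝ} (hc : 0 ≤ c) :
    IsEigenvectorMatrix (Matrix.diagonal (spikeScale q s) *
      (c • (sampleCov (fun i => (WithLp.toLp 2 (whitening Γ s *ᵥ (x i).ofLp) :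
        EuclideanSpace ℝ (Fin (q + 1)))) - 1)) * Matrix.diagonal (spikeScale q s) +
      diagFirst q (c * s)) (Uᵀ * Γ)ᵀ := by
  have h1 := diagonal_spikeScale_mul_inv (q := q) hs
  have h2 := mul_eq_one_comm.1 h1
  have h3 : diagFirst q (c * s) = c • diagFirst q s := by
    rw [diagFirst, diagFirst, ← Matrix.diagonal_smul, ← Pi.single_smul, smul_eq_mul]
  have h4 : Matrix.diagonal (spikeScale q s) *
      (whitening Γ s * sampleCov x * (whitening Γ s)ᵀ) * Matrix.diagonal (spikeScale q s) =
      Γᵀ * sampleCov x * Γ := by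
    rw [whitening, Matrix.transpose_mul, Matrix.transpose_transpose, Matrix.diagonal_transpose]
    calc _ = (Matrix.diagonal (spikeScale q s) * Matrix.diagonal (spikeScale q s)⁻¹) *
          (Γᵀ * sampleCov x * Γ) *
          (Matrix.diagonal (spikeScale q s)⁻¹ * Matrix.diagonal (spikeScale q s)) := by
          simp only [Matrix.mul_assoc]
      _ = _ := by rw [h1, h2, Matrix.one_mul, Matrix.mul_one]
  have h5 : Matrix.diagonal (spikeScale q s) *
      (c • (sampleCov (fun i => (WithLp.toLp 2 (whitening Γ s *ᵥ (x i).ofLp) :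
        EuclideanSpace ℝ (Fin (q + 1)))) - 1)) * Matrix.diagonal (spikeScale q s) +
      diagFirst q (c * s) = c • (Γᵀ * sampleCov x * Γ - 1) := by
    rw [sampleCov_mulVec, h3, Matrix.mul_smul, Matrix.smul_mul, ← smul_add, Matrix.mul_sub,
      Matrix.sub_mul, h4, Matrix.mul_one, diagonal_spikeScale_mul_self hs]
    congr 1
    abel
  rw [h5, Matrix.transpose_mul, Matrix.transpose_transpose]
  exact (h.conj hΓ).smul_sub_one hc

end Reduction

/-! ### Asymptotics in the strong and weak spike regimes -/

section Asymptotics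

open scoped RealInnerProductSpace

variable {q : ℕ}

theorem diagonal_mul_mul_diagonal_apply (d : Fin (q + 1) → ℝ)
    (H : Matrix (Fin (q + 1)) (Fin (q + 1)) ℝ) (i j : Fin (q + 1)) :
    (Matrix.diagonal d * H * Matrix.diagonal d) i j = d i * H i j * d j := by
  rw [Matrix.mul_diagonal, Matrix.diagonal_mul]

theorem tendsto_spikeScale {s : ℕ → ℝ} {s₀ : ℝ} (hs : Tendsto s atTop (𝓝 s₀))
    (i : Fin (q + 1)) : Tendsto (fun n => spikeScale q (s n) i) atTop (𝓝 (spikeScale q s₀ i)) := by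
  refine Fin.cases ?_ (fun i => ?_) i
  · exact (hs.const_add 1).sqrt
  · exact tendsto_const_nhds

/-- The below-diagonal part of the first column, rescaled, as a function of the stacked matrix. -/
def scaledBlock21 (κ : ℝ) (x : EuclideanSpace ℝ (Fin (q + 1) × Fin (q + 1))) :
    EuclideanSpace ℝ (Fin q) :=
  WithLp.toLp 2 fun i => κ * x (0, i.succ)

theorem continuous_scaledBlock21 (κ : ℝ) : Continuous (scaledBlock21 (q := q) κ) := by
  unfold scaledBlock21
  fun_prop

/-- The commutation matrix pairs position `(0, i)` with `(i, 0)`, which is outside this block when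
`i ≠ 0`; so only the identity part of the covariance survives. -/
theorem hasLaw_scaledBlock21 {κ σ : ℝ} (hκ : κ ^ 2 = σ) :
    HasLaw (scaledBlock21 (q := q) κ)
      (multivariateGaussian 0 (σ • (1 : Matrix (Fin q) (Fin q) ℝ)))
      (multivariateGaussian 0 (1 + commutationMatrix (q + 1))) := by
  have hσ : 0 ≤ σ := hκ ▸ sq_nonneg κ
  refine hasLaw_multivariateGaussian_comp (posSemidef_one_add_commutationMatrix _)
    (Matrix.PosSemidef.one.smul hσ) HasLaw.id (continuous_scaledBlock21 κ)
    (fun t => WithLp.toLp 2 fun a => if a.1 = 0 then κ * (Fin.cons 0 t.ofLp : Fin (q + 1) → ℝ) a.2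
      else 0) (fun x t => ?_) fun t => ?_
  · simp only [PiLp.inner_apply, scaledBlock21, Fintype.sum_prod_type]
    rw [Fin.sum_univ_succ]
    simp [Fin.sum_univ_succ, Fin.succ_ne_zero]
    exact Finset.sum_congr rfl fun i _ => by ring
  · rw [one_add_commutationMatrix_mulVec, Matrix.smul_mulVec, Matrix.one_mulVec]
    simp only [dotProduct, Fintype.sum_prod_type, Prod.swap]
    rw [Fin.sum_univ_succ]
    simp [Fin.sum_univ_succ, Fin.succ_ne_zero, ← hκ]
    exact Finset.sum_congr rfl fun i _ => by ring

theorem sum_sq_row {p : ℕ} {E : Matrix (Fin p) (Fin p) ℝ}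
    (hE : Eᵀ ∈ Matrix.orthogonalGroup (Fin p) ℝ) (j : Fin p) : ∑ k, E j k ^ 2 = 1 := by
  have := orthogonal_col_dotProduct hE j j
  simpa [dotProduct, pow_two] using this

theorem sum_sq_col {p : ℕ} {E : Matrix (Fin p) (Fin p) ℝ}
    (hE : Eᵀ ∈ Matrix.orthogonalGroup (Fin p) ℝ) (j : Fin p) : ∑ k, E k j ^ 2 = 1 := by
  have h1 := (Matrix.mem_orthogonalGroup_iff _ _).1 hE
  have := congrFun (congrFun h1 j) j
  rw [Matrix.mul_apply, Matrix.one_apply_eq] at this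
  simpa [pow_two] using this

theorem block22_mul_transpose_sub_one {E : Matrix (Fin (q + 1)) (Fin (q + 1)) ℝ}
    (hE : Eᵀ ∈ Matrix.orthogonalGroup (Fin (q + 1)) ℝ) (i j : Fin q) :
    (block22 E * (block22 E)ᵀ - 1) i j = -(E i.succ 0 * E j.succ 0) := by
  have h := orthogonal_col_dotProduct hE i.succ j.succ
  rw [dotProduct, Fin.sum_univ_succ] at h
  simp only [Matrix.col_apply, Matrix.transpose_apply, Fin.succ_inj] at h
  rw [Matrix.sub_apply, Matrix.mul_apply, Matrix.one_apply, ← h]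
  simp [block22]

/-- Orthogonality of the first column of `E` to the others. It reduces the limit law of this block
to that of the first row. -/
theorem block22T21_apply {E : Matrix (Fin (q + 1)) (Fin (q + 1)) ℝ}
    (hE : Eᵀ ∈ Matrix.orthogonalGroup (Fin (q + 1)) ℝ) (j : Fin q) :
    block22T21 E j = -(E 0 j.succ * E 0 0) := by
  have h1 := (Matrix.mem_orthogonalGroup_iff _ _).1 hE
  have h := congrFun (congrFun h1 j.succ) 0
  rw [Matrix.mul_apply, Matrix.one_apply_ne (Fin.succ_ne_zero j), Fin.sum_univ_succ] at h
  simp only [Matrix.transpose_apply] at h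
  rw [← sub_eq_zero, sub_neg_eq_add, add_comm, ← h]
  rfl

/-- The first row and first column are unit vectors sharing the corner entry. -/
theorem norm_block21_eq {E : Matrix (Fin (q + 1)) (Fin (q + 1)) ℝ}
    (hE : Eᵀ ∈ Matrix.orthogonalGroup (Fin (q + 1)) ℝ) : ‖block21 E‖ = ‖block12 E‖ := by
  rw [← sq_eq_sq₀ (norm_nonneg _) (norm_nonneg _), EuclideanSpace.real_norm_sq_eq,
    EuclideanSpace.real_norm_sq_eq]
  have h1 := sum_sq_row hE 0
  have h2 := sum_sq_col hE 0
  rw [Fin.sum_univ_succ] at h1 h2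
  simp only [block21, block12]
  linarith

variable {Ω : ℕ → Type*} [∀ n, MeasurableSpace (Ω n)] {P : ∀ n, Measure (Ω n)}
  [∀ n, IsProbabilityMeasure (P n)]
  {H E : ∀ n, Ω n → Matrix (Fin (q + 1)) (Fin (q + 1)) ℝ}

/-- The regime in which the leading eigenvector is consistently estimated. -/
theorem asymptotics_of_tendsto_atTop
    (hH : TendstoInDistribution (fun n ω => vecE (H n ω)) atTop id P
      (multivariateGaussian 0 (1 + commutationMatrix (q + 1))))
    (hEm : ∀ n, AEMeasurable (fun ω => vecE (E n ω)) (P n))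
    {r : ℕ → ℝ} {v ρ σ : ℝ} (hv : 0 < v) (hρ : 0 ≤ ρ) (hr : Tendsto r atTop (𝓝 ρ))
    (hr' : Tendsto (fun n : ℕ => √(n : ℝ) * r n) atTop atTop)
    (hE : ∀ᶠ n : ℕ in atTop, ∀ᵐ ω ∂(P n), IsEigenvectorMatrix
      (Matrix.diagonal (spikeScale q (r n * v)) * H n ω * Matrix.diagonal (spikeScale q (r n * v)) +
        diagFirst q (√(n : ℝ) * (r n * v))) (E n ω)ᵀ ∧ ∀ j, 0 ≤ E n ω j 0)
    (hσ : σ = v⁻¹ ^ 2 * (1 + ρ * v)) :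
    IsLittleOP P (fun n ω => E n ω 0 0 - 1) ∧
      IsLittleOP P (fun n ω => vecE (block22 (E n ω) * (block22 (E n ω))ᵀ - 1)) ∧
      IsBigOP P (fun (n : ℕ) ω => (√(n : ℝ) * r n) • block21 (E n ω)) ∧
      TendstoInDistribution (fun (n : ℕ) ω => (√(n : ℝ) * r n) • block22T21 (E n ω)) atTop
        id P (multivariateGaussian 0 (σ • (1 : Matrix (Fin q) (Fin q) ℝ))) ∧
      TendstoInDistribution (fun (n : ℕ) ω => (√(n : ℝ) * r n) • block12 (E n ω)) atTop
        id P (multivariateGaussian 0 (σ • (1 : Matrix (Fin q) (Fin q) ℝ))) := by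
  set good : ∀ n, Ω n → Prop := fun n ω => IsEigenvectorMatrix
      (Matrix.diagonal (spikeScale q (r n * v)) * H n ω * Matrix.diagonal (spikeScale q (r n * v)) +
        diagFirst q (√(n : ℝ) * (r n * v))) (E n ω)ᵀ ∧ ∀ j, 0 ≤ E n ω j 0 with hgood
  -- The limit of `spikeScale q (r n * v) 0 / v`, the factor between `H` and the rescaled first row.
  set κ : ℝ := √(1 + ρ * v) / v with hκ
  have hκσ : κ ^ 2 = σ := by
    rw [hκ, hσ, div_pow, Real.sq_sqrt (by positivity), inv_pow]
    ring
  have hHb := hH.isBigOP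
  have hEm' := fun n => aemeasurable_vecE.1 (hEm n)
  have hs : Tendsto (fun n => r n * v) atTop (𝓝 (ρ * v)) := hr.mul_const v
  have hd := fun i => tendsto_spikeScale (q := q) hs i
  -- the deterministic analysis on the events where the normalized matrix is bounded
  have main : ∀ K : ℝ, let l := uniformFilter fun n ω => good n ω ∧ ‖vecE (H n ω)‖ ≤ K
      (∀ᶠ p : Σ n, Ω n in l, (E p.1 p.2)ᵀ ∈ Matrix.orthogonalGroup (Fin (q + 1)) ℝ) ∧
      (∀ i j, IsBoundedUnder (· ≤ ·) l ((‖·‖) ∘ fun p : Σ n, Ω n => H p.1 p.2 i j)) ∧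
      Tendsto (fun p : Σ n, Ω n => E p.1 p.2 0 0) l (𝓝 1) ∧
      ∀ i : Fin q, Tendsto (fun p : Σ n, Ω n => √(p.1 : ℝ) * r p.1 * E p.1 p.2 0 i.succ -
        κ * H p.1 p.2 i.succ 0) l (𝓝 0) := by
    intro K l
    have hfst : Tendsto Sigma.fst l atTop := tendsto_fst_uniformFilter _
    have hHK : ∀ᶠ p : Σ n, Ω n in l, ∀ i j, |H p.1 p.2 i j| ≤ K :=
      eventually_uniformFilter.2 (Eventually.of_forall fun n ω h i j =>
        (abs_apply_le_norm_vecE _ i j).trans h.2)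
    have hHb : ∀ i j, IsBoundedUnder (· ≤ ·) l ((‖·‖) ∘ fun p : Σ n, Ω n => H p.1 p.2 i j) :=
      fun i j => isBoundedUnder_of_eventually_le (a := K) (hHK.mono fun p h => h i j)
    obtain ⟨D, hD⟩ : ∃ D : ℝ, ∀ᶠ n in atTop, ∀ i, |spikeScale q (r n * v) i| ≤ D := by
      refine ⟨∑ i, (|spikeScale q (ρ * v) i| + 1), ?_⟩
      rw [eventually_all]
      intro i
      filter_upwards [(hd i).abs.eventually_lt_const (lt_add_one _)] with n hn
      exact hn.le.trans (Finset.single_le_sum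
        (f := fun i => |spikeScale q (ρ * v) i| + 1) (fun i _ => by positivity)
        (Finset.mem_univ i))
    obtain ⟨h1, h2⟩ := tendsto_leading_eigenvector (l := l)
      (c := fun p : Σ n, Ω n => √(p.1 : ℝ) * r p.1) (hr'.comp hfst) hv
      (T := fun p : Σ n, Ω n => Matrix.diagonal (spikeScale q (r p.1 * v)) * H p.1 p.2 *
        Matrix.diagonal (spikeScale q (r p.1 * v)))
      (E := fun p : Σ n, Ω n => E p.1 p.2) (κ := D * K * D)
      (by
        filter_upwards [hHK, hfst.eventually hD] with p h1 h2 i j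
        have hD0 : 0 ≤ D := (abs_nonneg _).trans (h2 0)
        have hK0 : 0 ≤ K := (abs_nonneg _).trans (h1 0 0)
        rw [diagonal_mul_mul_diagonal_apply, abs_mul, abs_mul]
        exact mul_le_mul (mul_le_mul (h2 i) (h1 i j) (abs_nonneg _) hD0) (h2 j) (abs_nonneg _)
          (mul_nonneg hD0 hK0))
      (eventually_uniformFilter.2 (Eventually.of_forall fun n ω h => by
        have h1 := h.1.1
        rw [← mul_assoc √(n : ℝ)] at h1
        exact h1))
      (eventually_uniformFilter.2 (Eventually.of_forall fun n ω h => h.1.2 0))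
    refine ⟨eventually_uniformFilter.2 (Eventually.of_forall fun n ω h => h.1.1.1), hHb, h1,
      fun i => ?_⟩
    have h3 : Tendsto (fun p : Σ n, Ω n => (spikeScale q (r p.1 * v) 0 / v - κ) *
        H p.1 p.2 i.succ 0) l (𝓝 0) := by
      refine Tendsto.zero_mul_isBoundedUnder_le ?_ (hHb _ _)
      have := (((hd 0).div_const v).sub_const κ).comp hfst
      rwa [spikeScale_zero, ← hκ, sub_self] at this
    have h4 := (h2 i).add h3
    rw [add_zero] at h4
    refine h4.congr fun p => ?_
    rw [diagonal_mul_mul_diagonal_apply, spikeScale_succ]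
    ring
  have hb12 : TendstoInDistribution (fun (n : ℕ) ω => (√(n : ℝ) * r n) • block12 (E n ω)) atTop
      id P (multivariateGaussian 0 (σ • (1 : Matrix (Fin q) (Fin q) ℝ))) := by
    refine TendstoInDistribution.of_isLittleOP_sub ((hH.continuous_comp
      (continuous_scaledBlock21 κ)).of_hasLaw (hasLaw_scaledBlock21 hκσ)) (fun n => ?_) ?_
    · have : AEMeasurable (fun ω => fun j : Fin q => E n ω 0 j.succ) (P n) :=
        aemeasurable_pi_lambda _ fun j => hEm' n 0 j.succ
      simp only [block12]
      fun_prop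
    · refine isLittleOP_of_uniformFilter hHb hE fun K => ?_
      obtain ⟨-, -, -, h⟩ := main K
      exact tendsto_toLp_zero h
  refine ⟨?_, ?_, ?_, ?_, hb12⟩
  · refine isLittleOP_of_uniformFilter hHb hE fun K => ?_
    obtain ⟨-, -, h, -⟩ := main K
    simpa using h.sub_const 1
  · refine isLittleOP_of_uniformFilter hHb hE fun K => ?_
    obtain ⟨ho, -, h, -⟩ := main K
    -- The first column has unit length and its top entry tends to one.
    have h21 : ∀ i : Fin q, Tendsto (fun p : Σ n, Ω n => E p.1 p.2 i.succ 0)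
        (uniformFilter fun n ω => good n ω ∧ ‖vecE (H n ω)‖ ≤ K) (𝓝 0) := by
      intro i
      have h0 : Tendsto (fun p : Σ n, Ω n => √(1 - E p.1 p.2 0 0 ^ 2))
          (uniformFilter fun n ω => good n ω ∧ ‖vecE (H n ω)‖ ≤ K) (𝓝 √(1 - 1 ^ 2)) :=
        ((h.pow 2).const_sub 1).sqrt
      rw [one_pow, sub_self, Real.sqrt_zero] at h0
      refine squeeze_zero_norm' ?_ h0
      filter_upwards [ho] with p hp
      have h1 := sum_sq_col hp 0
      rw [Fin.sum_univ_succ] at h1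
      have h2 := Finset.single_le_sum (f := fun i : Fin q => E p.1 p.2 i.succ 0 ^ 2)
        (fun i _ => sq_nonneg _) (Finset.mem_univ i)
      refine Real.le_sqrt_of_sq_le ?_
      rw [Real.norm_eq_abs, sq_abs]
      linarith
    refine tendsto_vecE_zero fun i j => ?_
    have h3 := ((h21 i).mul (h21 j)).neg
    rw [mul_zero, neg_zero] at h3
    refine h3.congr' ?_
    filter_upwards [ho] with p hp
    rw [block22_mul_transpose_sub_one hp]
  · refine isBigOP_of_norm_le hb12.isBigOP (fun n => ?_) ?_
    · have : AEMeasurable (fun ω => fun j : Fin q => E n ω j.succ 0) (P n) :=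
        aemeasurable_pi_lambda _ fun j => hEm' n j.succ 0
      simp only [block21]
      fun_prop
    · filter_upwards [hE] with n hn
      filter_upwards [hn] with ω hω
      rw [norm_smul, norm_smul, norm_block21_eq hω.1.1]
  -- The sign of `-κ` comes from orthogonality; the limiting covariance depends only on its square.
  · refine TendstoInDistribution.of_isLittleOP_sub ((hH.continuous_comp
      (continuous_scaledBlock21 (-κ))).of_hasLaw
      (hasLaw_scaledBlock21 (by rw [neg_sq, hκσ]))) (fun n => ?_) ?_
    · have : AEMeasurable (fun ω => fun j : Fin q => ∑ i : Fin q,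
          E n ω i.succ j.succ * E n ω i.succ 0) (P n) :=
        aemeasurable_pi_lambda _ fun j => by
          have := hEm' n
          fun_prop
      have h2 : AEMeasurable (fun ω => block22T21 (E n ω)) (P n) :=
        (WithLp.measurable_toLp 2 _).comp_aemeasurable this
      fun_prop
    · refine isLittleOP_of_uniformFilter hHb hE fun K => ?_
      obtain ⟨ho, hb, h00, h⟩ := main K
      have key : Tendsto (fun p : Σ n, Ω n => (WithLp.toLp 2 fun i : Fin q =>
          -(E p.1 p.2 0 0) * (√(p.1 : ℝ) * r p.1 * E p.1 p.2 0 i.succ -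
            κ * H p.1 p.2 i.succ 0) + (1 - E p.1 p.2 0 0) * κ * H p.1 p.2 i.succ 0 :
          EuclideanSpace ℝ (Fin q)))
          (uniformFilter fun n ω => good n ω ∧ ‖vecE (H n ω)‖ ≤ K) (𝓝 0) := by
        refine tendsto_toLp_zero fun i => ?_
        have h1 := h00.neg.mul (h i)
        have h2 : Tendsto (fun p : Σ n, Ω n => (1 - E p.1 p.2 0 0) * κ * H p.1 p.2 i.succ 0)
            (uniformFilter fun n ω => good n ω ∧ ‖vecE (H n ω)‖ ≤ K) (𝓝 0) := by
          refine Tendsto.zero_mul_isBoundedUnder_le ?_ (hb _ _)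
          simpa using (h00.const_sub 1).mul_const κ
        simpa using h1.add h2
      refine key.congr' ?_
      filter_upwards [ho] with p hp
      ext i
      rw [PiLp.sub_apply, PiLp.smul_apply, block22T21_apply hp]
      simp only [scaledBlock21, Function.comp_apply, vecE_apply, smul_eq_mul]
      ring

/-- The regime in which the spike is of the order of the noise, or smaller. -/
theorem asymptotics_of_tendsto_nhds
    (hH : TendstoInDistribution (fun n ω => vecE (H n ω)) atTop id P
      (multivariateGaussian 0 (1 + commutationMatrix (q + 1))))
    (hEm : ∀ n, AEMeasurable (fun ω => vecE (E n ω)) (P n))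
    {s : ℕ → ℝ} {a : ℝ} (hs : Tendsto (fun n : ℕ => √(n : ℝ) * s n) atTop (𝓝 a))
    (hE : ∀ᶠ n : ℕ in atTop, ∀ᵐ ω ∂(P n), IsEigenvectorMatrix
      (Matrix.diagonal (spikeScale q (s n)) * H n ω * Matrix.diagonal (spikeScale q (s n)) +
        diagFirst q (√(n : ℝ) * s n)) (E n ω)ᵀ ∧ ∀ j, 0 ≤ E n ω j 0)
    {Ω' : Type*} [MeasurableSpace Ω'] {P' : Measure Ω'} [IsProbabilityMeasure P']
    {Z F : Ω' → Matrix (Fin (q + 1)) (Fin (q + 1)) ℝ}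
    (hZ : HasLaw (fun ω => vecE (Z ω)) (multivariateGaussian 0 (1 + commutationMatrix (q + 1))) P')
    (hFm : AEMeasurable (fun ω => vecE (F ω)) P')
    (hF : ∀ᵐ ω ∂P', IsEigenvectorMatrix (Z ω + diagFirst q a) (F ω)ᵀ ∧ ∀ j, 0 ≤ F ω j 0) :
    TendstoInDistribution (fun n ω => vecE (E n ω)) atTop (fun ω => vecE (F ω)) P P' := by
  -- The spike itself vanishes, so the scaling matrices tend to the identity and affect nothing in
  -- the limit.
  have hs0 : Tendsto s atTop (𝓝 0) := by
    have h1 : Tendsto (fun n : ℕ => (√(n : ℝ))⁻¹) atTop (𝓝 0) :=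
      tendsto_inv_atTop_zero.comp (Real.tendsto_sqrt_atTop.comp tendsto_natCast_atTop_atTop)
    have h2 := h1.mul hs
    rw [zero_mul] at h2
    refine h2.congr' ?_
    filter_upwards [eventually_gt_atTop 0] with n hn
    have : √(n : ℝ) ≠ 0 := (Real.sqrt_pos.2 (Nat.cast_pos.2 hn)).ne'
    field_simp
  have hd : ∀ i, Tendsto (fun n => spikeScale q (s n) i) atTop (𝓝 1) := fun i => by
    have h := tendsto_spikeScale (q := q) hs0 i
    have h1 : spikeScale q 0 i = 1 := by
      refine Fin.cases ?_ (fun i => ?_) i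
      · simp [spikeScale_zero]
      · rfl
    rwa [h1] at h
  refine tendstoInDistribution_eigenvectors (B := fun ω => Z ω + diagFirst q a) ?_
    (ae_firstNonvanishing hZ _) hEm hFm hE hF
  have hlim : TendstoInDistribution (fun n ω => vecE (H n ω) + vecE (diagFirst q a)) atTop
      (fun ω => vecE (Z ω + diagFirst q a)) P P' :=
    (hH.of_hasLaw' hZ).continuous_comp (g := fun x => x + vecE (diagFirst q a)) (by fun_prop)
  refine hlim.of_isLittleOP_sub (fun n => ?_) ?_
  · have hHm := aemeasurable_vecE.1 (hH.forall_aemeasurable n)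
    rw [aemeasurable_vecE]
    intro i j
    simp only [Matrix.add_apply, diagonal_mul_mul_diagonal_apply]
    fun_prop
  · refine isLittleOP_of_uniformFilter (good := fun _ _ => True) hH.isBigOP
      (Eventually.of_forall fun n => ae_of_all _ fun _ => trivial) fun K => ?_
    have key : Tendsto (fun p : Σ n, Ω n => vecE (Matrix.of fun i j =>
        (spikeScale q (s p.1) i * spikeScale q (s p.1) j - 1) * H p.1 p.2 i j +
          (if i = 0 ∧ j = 0 then √(p.1 : ℝ) * s p.1 - a else 0)))
        (uniformFilter fun n ω => True ∧ ‖vecE (H n ω)‖ ≤ K) (𝓝 0) := by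
      have hfst := tendsto_fst_uniformFilter fun n ω => True ∧ ‖vecE (H n ω)‖ ≤ K
      refine tendsto_vecE_zero fun i j => ?_
      simp only [Matrix.of_apply]
      rw [show 𝓝 (0 : ℝ) = 𝓝 (0 + 0) by rw [add_zero]]
      refine Tendsto.add ?_ ?_
      · refine Tendsto.zero_mul_isBoundedUnder_le ?_
          (isBoundedUnder_of_eventually_le (a := K) (eventually_uniformFilter.2
            (Eventually.of_forall fun n ω h => (abs_apply_le_norm_vecE _ i j).trans h.2)))
        simpa [Function.comp_def] using ((((hd i).mul (hd j)).sub_const 1).comp hfst)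
      · split_ifs
        · simpa [Function.comp_def] using (hs.sub_const a).comp hfst
        · exact tendsto_const_nhds
    refine key.congr fun p => ?_
    ext ⟨j, i⟩
    simp only [vecE_apply, PiLp.sub_apply, PiLp.add_apply, Matrix.add_apply, Matrix.of_apply,
      diagonal_mul_mul_diagonal_apply, diagFirst, Matrix.diagonal_apply]
    by_cases hij : i = j
    · subst hij
      by_cases hi : i = 0
      · subst hi
        simp
        ring
      · simp [hi]
        ring
    · have : ¬ (i = 0 ∧ j = 0) := fun h => hij (h.1.trans h.2.symm)
      simp [hij, this]
      ring

end Asymptotics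

end SpikedPCA

/-! ### The four regimes -/

theorem lemma2p3 {q : ℕ} (θ : EuclideanSpace ℝ (Fin (q + 1))) (hθ : ‖θ‖ = 1)
    (v : ℝ) (hv : 0 < v)
    (r : ℕ → ℝ) (hr_pos : ∀ n, 1 ≤ n → 0 < r n) (hr_bdd : ∃ C : ℝ, ∀ n, 1 ≤ n → r n ≤ C)
    -- the triangular array of Gaussian observations
    {Ω : ℕ → Type*} [∀ n, MeasurableSpace (Ω n)]
    (P : ∀ n, Measure (Ω n)) [∀ n, IsProbabilityMeasure (P n)]
    (X : ∀ n, Fin n → Ω n → EuclideanSpace ℝ (Fin (q + 1)))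
    (hX_indep : ∀ n, iIndepFun (X n) (P n))
    (hX_law : ∀ n i, HasLaw (X n i)
      (multivariateGaussian 0 (SpikedPCA.spikedCov (r n * v) θ)) (P n))
    -- an orthogonal matrix with first column `θ`
    (Γ : Matrix (Fin (q + 1)) (Fin (q + 1)) ℝ)
    (hΓ : Γ ∈ Matrix.orthogonalGroup (Fin (q + 1)) ℝ) (hΓθ : Γ.col 0 = θ.ofLp)
    -- the sample eigenvectors, with their sign normalization
    (Γhat : ∀ n, Ω n → Matrix (Fin (q + 1)) (Fin (q + 1)) ℝ)
    (hΓhat_meas : ∀ n, AEMeasurable (fun ω => SpikedPCA.vecE (Γhat n ω)) (P n))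
    (hΓhat_eig : ∀ n, q + 1 ≤ n → ∀ᵐ ω ∂(P n),
      SpikedPCA.IsEigenvectorMatrix (SpikedPCA.sampleCov fun i => X n i ω) (Γhat n ω))
    (E : ∀ n, Ω n → Matrix (Fin (q + 1)) (Fin (q + 1)) ℝ)
    (hE : ∀ n ω, E n ω = (Γhat n ω)ᵀ * Γ)
    (hE_sign : ∀ n, q + 1 ≤ n → ∀ᵐ ω ∂(P n), ∀ j, 0 < E n ω j 0)
    -- the limiting Gaussian matrix and the associated eigenvector matrices
    {Ω' : Type*} [MeasurableSpace Ω'] (P' : Measure Ω') [IsProbabilityMeasure P']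
    (Z : Ω' → Matrix (Fin (q + 1)) (Fin (q + 1)) ℝ)
    (hZ : HasLaw (fun ω => SpikedPCA.vecE (Z ω))
      (multivariateGaussian 0 (1 + SpikedPCA.commutationMatrix (q + 1))) P')
    (Elim : ℝ → Ω' → Matrix (Fin (q + 1)) (Fin (q + 1)) ℝ)
    (hElim_meas : ∀ a, 0 ≤ a → AEMeasurable (fun ω => SpikedPCA.vecE (Elim a ω)) P')
    (hElim_eig : ∀ a, 0 ≤ a → ∀ᵐ ω ∂P',
      SpikedPCA.IsEigenvectorMatrix (Z ω + SpikedPCA.diagFirst q a) (Elim a ω)ᵀ)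
    (hElim_sign : ∀ a, 0 ≤ a → ∀ᵐ ω ∂P', ∀ j, 0 < Elim a ω j 0) :
    -- (i)
    ((∀ n, 1 ≤ n → r n = 1) →
      SpikedPCA.IsLittleOP P (fun n ω => E n ω 0 0 - 1) ∧
      SpikedPCA.IsLittleOP P (fun n ω => SpikedPCA.vecE
        (SpikedPCA.block22 (E n ω) * (SpikedPCA.block22 (E n ω))ᵀ - 1)) ∧
      SpikedPCA.IsBigOP P (fun (n : ℕ) ω => √(n : ℝ) • SpikedPCA.block21 (E n ω)) ∧
      TendstoInDistribution (fun (n : ℕ) ω => √(n : ℝ) • SpikedPCA.block22T21 (E n ω)) atTop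
        id P (multivariateGaussian 0 ((v⁻¹ ^ 2 * (1 + v)) • (1 : Matrix (Fin q) (Fin q) ℝ))) ∧
      TendstoInDistribution (fun (n : ℕ) ω => √(n : ℝ) • SpikedPCA.block12 (E n ω)) atTop
        id P (multivariateGaussian 0 ((v⁻¹ ^ 2 * (1 + v)) • (1 : Matrix (Fin q) (Fin q) ℝ)))) ∧
    -- (ii)
    (r =o[atTop] (fun _ => (1 : ℝ)) → Tendsto (fun n : ℕ => √(n : ℝ) * r n) atTop atTop →
      SpikedPCA.IsLittleOP P (fun n ω => E n ω 0 0 - 1) ∧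
      SpikedPCA.IsLittleOP P (fun n ω => SpikedPCA.vecE
        (SpikedPCA.block22 (E n ω) * (SpikedPCA.block22 (E n ω))ᵀ - 1)) ∧
      SpikedPCA.IsBigOP P (fun (n : ℕ) ω => (√(n : ℝ) * r n) • SpikedPCA.block21 (E n ω)) ∧
      TendstoInDistribution
        (fun (n : ℕ) ω => (√(n : ℝ) * r n) • SpikedPCA.block22T21 (E n ω)) atTop
        id P (multivariateGaussian 0 ((v⁻¹ ^ 2) • (1 : Matrix (Fin q) (Fin q) ℝ))) ∧
      TendstoInDistribution
        (fun (n : ℕ) ω => (√(n : ℝ) * r n) • SpikedPCA.block12 (E n ω)) atTop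
        id P (multivariateGaussian 0 ((v⁻¹ ^ 2) • (1 : Matrix (Fin q) (Fin q) ℝ)))) ∧
    -- (iii)
    ((∀ n : ℕ, 1 ≤ n → r n = 1 / √(n : ℝ)) →
      TendstoInDistribution (fun n ω => SpikedPCA.vecE (E n ω)) atTop
        (fun ω => SpikedPCA.vecE (Elim v ω)) P P') ∧
    -- (iv)
    (r =o[atTop] (fun n : ℕ => 1 / √(n : ℝ)) →
      TendstoInDistribution (fun n ω => SpikedPCA.vecE (E n ω)) atTop
        (fun ω => SpikedPCA.vecE (Elim 0 ω)) P P') := by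
  have hs0 : ∀ n, 1 ≤ n → 0 ≤ r n * v := fun n hn => (mul_pos (hr_pos n hn) hv).le
  set H : ∀ n, Ω n → Matrix (Fin (q + 1)) (Fin (q + 1)) ℝ := fun n ω =>
    √(n : ℝ) • (SpikedPCA.sampleCov (fun i => (WithLp.toLp 2
      (SpikedPCA.whitening Γ (r n * v) *ᵥ (X n i ω).ofLp) : EuclideanSpace ℝ (Fin (q + 1)))) - 1)
  have hH : TendstoInDistribution (fun n ω => SpikedPCA.vecE (H n ω)) atTop id P
      (multivariateGaussian 0 (1 + SpikedPCA.commutationMatrix (q + 1))) := by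
    refine SpikedPCA.tendstoInDistribution_sampleCov
      (U := fun n i ω => WithLp.toLp 2 (SpikedPCA.whitening Γ (r n * v) *ᵥ (X n i ω).ofLp))
      (fun n => (hX_indep n).comp (fun _ x => WithLp.toLp 2
        (SpikedPCA.whitening Γ (r n * v) *ᵥ x.ofLp)) fun _ => ?_) fun n i => ?_
    · refine Continuous.measurable ?_
      fun_prop
    -- An index in `Fin n` forces `n ≥ 1`, where `r n` is known to be positive.
    · exact SpikedPCA.hasLaw_whitening hΓ hΓθ (hs0 n (Nat.succ_le_of_lt i.pos)) (hX_law n i)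
  have hEm : ∀ n, AEMeasurable (fun ω => SpikedPCA.vecE (E n ω)) (P n) := by
    intro n
    have h := SpikedPCA.aemeasurable_vecE.1 (hΓhat_meas n)
    rw [SpikedPCA.aemeasurable_vecE]
    intro i j
    simp only [hE, Matrix.mul_apply, Matrix.transpose_apply]
    fun_prop
  have hEig : ∀ᶠ n : ℕ in atTop, ∀ᵐ ω ∂(P n), SpikedPCA.IsEigenvectorMatrix
      (Matrix.diagonal (SpikedPCA.spikeScale q (r n * v)) * H n ω *
        Matrix.diagonal (SpikedPCA.spikeScale q (r n * v)) +
        SpikedPCA.diagFirst q (√(n : ℝ) * (r n * v))) (E n ω)ᵀ ∧ ∀ j, 0 ≤ E n ω j 0 := by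
    filter_upwards [eventually_ge_atTop (q + 1)] with n hn
    filter_upwards [hΓhat_eig n hn, hE_sign n hn] with ω h1 h2
    refine ⟨?_, fun j => (h2 j).le⟩
    rw [hE]
    exact SpikedPCA.isEigenvectorMatrix_of_sampleCov hΓ (hs0 n (by omega)) h1 (Real.sqrt_nonneg _)
  have hlim : ∀ a, 0 ≤ a → ∀ᵐ ω ∂P',
      SpikedPCA.IsEigenvectorMatrix (Z ω + SpikedPCA.diagFirst q a) (Elim a ω)ᵀ ∧
        ∀ j, 0 ≤ Elim a ω j 0 := by
    intro a ha
    filter_upwards [hElim_eig a ha, hElim_sign a ha] with ω h1 h2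
    exact ⟨h1, fun j => (h2 j).le⟩
  have hsqrt : Tendsto (fun n : ℕ => √(n : ℝ)) atTop atTop :=
    Real.tendsto_sqrt_atTop.comp tendsto_natCast_atTop_atTop
  refine ⟨fun hr => ?_, fun hr hr' => ?_, fun hr => ?_, fun hr => ?_⟩
  · have hr1 : ∀ᶠ n in atTop, (1 : ℝ) = r n :=
      (eventually_ge_atTop 1).mono fun n hn => (hr n hn).symm
    have hlim1 := SpikedPCA.asymptotics_of_tendsto_atTop hH hEm hv zero_le_one
      (tendsto_const_nhds.congr' hr1)
      (hsqrt.congr' (hr1.mono fun n hn => by beta_reduce; rw [← hn, mul_one])) hEig (by rw [one_mul])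
    obtain ⟨h1, h2, h3, h4, h5⟩ := hlim1
    -- At `n = 0` the value of `r` is unconstrained, but both sides vanish because `√0 = 0`.
    have hscale : ∀ {F : Type} [AddCommGroup F] [Module ℝ F] (b : ∀ n, Ω n → F),
        (fun (n : ℕ) (ω : Ω n) => (√(n : ℝ) * r n) • b n ω) =
          fun (n : ℕ) (ω : Ω n) => √(n : ℝ) • b n ω := by
      intro F _ _ b
      funext n ω
      rcases Nat.eq_zero_or_pos n with rfl | hn
      · simp
      · rw [hr n hn, mul_one]
    rw [hscale] at h3
    rw [hscale (fun n ω => SpikedPCA.block22T21 (E n ω))] at h4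
    rw [hscale (fun n ω => SpikedPCA.block12 (E n ω))] at h5
    exact ⟨h1, h2, h3, h4, h5⟩
  · exact SpikedPCA.asymptotics_of_tendsto_atTop hH hEm hv le_rfl
      ((isLittleO_one_iff ℝ).1 hr) hr' hEig (by simp)
  · refine SpikedPCA.asymptotics_of_tendsto_nhds (s := fun n => r n * v) hH hEm
      (tendsto_const_nhds.congr' ?_) hEig hZ (hElim_meas v hv.le) (hlim v hv.le)
    filter_upwards [eventually_ge_atTop 1] with n hn
    have : √(n : ℝ) ≠ 0 := (Real.sqrt_pos.2 (Nat.cast_pos.2 hn)).ne'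
    rw [hr n hn]
    field_simp
  · refine SpikedPCA.asymptotics_of_tendsto_nhds (s := fun n => r n * v) hH hEm
      ?_ hEig hZ (hElim_meas 0 le_rfl) (hlim 0 le_rfl)
    have h := hr.tendsto_div_nhds_zero.mul_const v
    rw [zero_mul] at h
    refine h.congr fun n => ?_
    rw [div_div_eq_mul_div, div_one]
    ring
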